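/- Let $p>2$ be a prime. A $\sigma$-group is a topological group with a continuous action of a group $\{1,\sigma\}$ of order two by automorphisms; $G^-:=\{g\in G\mid {}^\sigma g=g^{-1}\}$ denotes its odd part, and $\sigma$-isomorphisms are $\sigma$-equivariant isomorphisms of topological groups. For $n\ge 0$ let $F_n$ be the free pro-$p$-group on generators $x_1,\dots,x_n$, with the action of $\sigma$ determined by ${}^\sigma x_i=x_i^{-1}$. The Haar measure on $F_n^-$ is the unique Borel probability measure such that, for every $\sigma$-invariant open normal subgroup $N$ of $F_n$, all fibres of $F_n^-\to (F_n/N)^-$ have measure $1/|(F_n/N)^-|$; the product measure of $n$ copies of it is the Haar measure $\tilde\mu_n$ on $(F_n^-)^n$. For $r=(r_1,\dots,r_n)\in (F_n^-)^n$ let $N_r$ be the closed normal subgroup of $F_n$ generated by all conjugates of $r_1,\dots,r_n$, and let $G_r:=F_n/N_r$ with the induced action of $\sigma$. Let $\mathrm{Sch}$ be the set of $\sigma$-isomorphism classes of the groups $G_r$ for all $n\ge0$ and all $r\in(F_n^-)^n$. Endow $\mathrm{Sch}$ with the topology generated by the sets $U_{i,G}=\{[H]\in\mathrm{Sch}\mid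 H/D_i(H)\cong G/D_i(G)\}$ for $i\ge2$ and $[G]\in\mathrm{Sch}$, where $\cong$ means $\sigma$-isomorphic and $D_i$ is the Zassenhaus filtration (the closed subgroups with $D_1(G)=G$ and $D_i(G)$ generated by $D_{\lceil i/p\rceil}(G)^p$ and all $[D_j(G),D_k(G)]$ with $j+k=i$, $j,k\ge 1$), and with the Borel $\sigma$-algebra. For $m\ge0$ let $\mathrm{Sch}_m\subset\mathrm{Sch}$ be the set of all $[G]$ with $d_G=m$, where $d_G=\dim_{\mathbb F_p}H^1(G,\mathbb F_p)=\dim_{\mathbb F_p}\mathrm{Hom}_{\mathrm{cont}}(G,\mathbb F_p)$ is the minimal number of topological generators of $G$. Let $\mu_n$ be the pushforward of $\tilde\mu_n$ under $\Theta_n\colon(F_n^-)^n\to\mathrm{Sch}$, $r\mapsto[G_r]$. For $0\le k<\infty$ and for $k=\infty$ put $C_k:=\prod_{i=1}^k(1-p^{-i})$. Theorem. There is a unique probability measure $\mu_\infty$ on $\mathrm{Sch}$ to which the measures $\mu_n$ converge for $n\to\infty$, in the sense that $\lim_{n\to\infty}\mu_n(A)=\mu_\infty(A)$ for every Borel subset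 $A\subset\mathrm{Sch}$. Moreover, for every $m\ge0$, $$\mu_\infty|\mathrm{Sch}_m\ =\ \frac{C_\infty}{C_m^2}\cdot\mu_m|\mathrm{Sch}_m .$$ -/

import Mathlib

open MeasureTheory Filter Topology
open scoped ENNReal

noncomputable section

/-! ### Groups with an action of a group `{1, σ}` of order two -/

/-- A continuous action of `{1, σ}` on a topological group by group automorphisms. -/
class SigmaGroup (G : Type*) [Group G] [TopologicalSpace G] where
  sigma : G →* G
  sigma_sigma : ∀ g, sigma (sigma g) = g
  continuous_sigma : Continuous sigma

open SigmaGroup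

/-- The odd part `G⁻` of a group with an action of `{1, σ}`. -/
def oddPart (G : Type*) [Group G] [TopologicalSpace G] [SigmaGroup G] : Set G :=
  {g | sigma g = g⁻¹}

/-- Existence of a `σ`-equivariant isomorphism of topological groups. -/
def SigmaIso (G H : Type*) [Group G] [TopologicalSpace G] [SigmaGroup G]
    [Group H] [TopologicalSpace H] [SigmaGroup H] : Prop :=
  ∃ e : G ≃ₜ* H, ∀ g, e (sigma g) = sigma (e g)

/-- A subgroup that is stable under `σ`. -/
class SigmaInvariant {G : Type*} [Group G] [TopologicalSpace G] [SigmaGroup G]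
    (N : Subgroup G) : Prop where
  sigma_mem : ∀ g ∈ N, sigma g ∈ N

/-- The induced action of `{1, σ}` on the quotient by a `σ`-invariant normal subgroup. -/
instance quotientSigmaGroup {G : Type*} [Group G] [TopologicalSpace G] [SigmaGroup G]
    (N : Subgroup G) [N.Normal] [SigmaInvariant N] : SigmaGroup (G ⧸ N) where
  sigma := QuotientGroup.map N N sigma (fun g hg => SigmaInvariant.sigma_mem g hg)
  sigma_sigma := by
    intro x
    induction x using QuotientGroup.induction_on with
    | H g =>
      change ((sigma (sigma g) : G) : G ⧸ N) = (g : G ⧸ N)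
      rw [sigma_sigma]
  continuous_sigma := by
    apply continuous_quot_lift
    exact QuotientGroup.continuous_mk.comp continuous_sigma

theorem sigma_mk {G : Type*} [Group G] [TopologicalSpace G] [SigmaGroup G]
    (N : Subgroup G) [N.Normal] [SigmaInvariant N] (g : G) :
    sigma (g : G ⧸ N) = ((sigma g : G) : G ⧸ N) := rfl

/-! ### The Zassenhaus filtration and the number of generators -/

/-- The Zassenhaus filtration of a topological group (closed subgroups throughout):
`D₁ = G` and `Dₙ` is the closed subgroup generated by the `p`-th powers of elements of
`D_⌈n/p⌉` and by the commutators `[Dᵢ, Dⱼ]` with `i + j = n`, `i, j ≥ 1`.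
(The value at `0` is an irrelevant convention.) -/
def zassenhaus (p : ℕ) [hp : Fact p.Prime] (G : Type*) [Group G] [TopologicalSpace G]
    [IsTopologicalGroup G] : ℕ → Subgroup G
  | 0 => ⊤
  | 1 => ⊤
  | n + 2 =>
    (Subgroup.closure ((fun x => x ^ p) '' (zassenhaus p G ((n + 2) ⌈/⌉ p) : Set G)) ⊔
      ⨆ i : Fin (n + 1), ⁅zassenhaus p G (i + 1), zassenhaus p G (n + 1 - i)⁆).topologicalClosure
  termination_by n => n
  decreasing_by
    · have h2 := hp.out.two_le
      have : (n + 2) ⌈/⌉ p ≤ n + 1 := by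
        rw [ceilDiv_le_iff_le_mul (by omega)]
        nlinarith
      omega
    · omega
    · omega

theorem zassenhaus_le_comap (p : ℕ) [hp : Fact p.Prime] {G H : Type*}
    [Group G] [TopologicalSpace G] [IsTopologicalGroup G]
    [Group H] [TopologicalSpace H] [IsTopologicalGroup H]
    (f : G →* H) (hf : Continuous f) (n : ℕ) :
    zassenhaus p G n ≤ (zassenhaus p H n).comap f := by
  induction n using Nat.strong_induction_on with
  | _ n ih =>
    match n, ih with
    | 0, _ => simp [zassenhaus]
    | 1, _ => simp [zassenhaus]
    | n + 2, ih =>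
      have h2 := hp.out.two_le
      have hlt : (n + 2) ⌈/⌉ p < n + 2 := by
        have : (n + 2) ⌈/⌉ p ≤ n + 1 := by
          rw [ceilDiv_le_iff_le_mul (by omega)]
          nlinarith
        omega
      rw [zassenhaus, zassenhaus]
      refine Subgroup.topologicalClosure_minimal _ ?_
        ((Subgroup.isClosed_topologicalClosure _).preimage hf)
      refine le_trans ?_ (Subgroup.comap_mono (Subgroup.le_topologicalClosure _))
      refine sup_le ?_ (iSup_le fun i => ?_)
      · rw [Subgroup.closure_le]
        rintro _ ⟨x, hx, rfl⟩
        exact Subgroup.mem_sup_left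
          (Subgroup.subset_closure ⟨f x, ih _ hlt hx, (map_pow f x p).symm⟩)
      · rw [← Subgroup.map_le_iff_le_comap, Subgroup.map_commutator]
        refine le_trans (Subgroup.commutator_mono ?_ ?_)
          (le_trans (le_iSup (fun i : Fin (n + 1) =>
            ⁅zassenhaus p H (i + 1), zassenhaus p H (n + 1 - i)⁆) i) le_sup_right)
        · exact Subgroup.map_le_iff_le_comap.2 (ih _ (by omega))
        · exact Subgroup.map_le_iff_le_comap.2 (ih _ (by omega))

instance zassenhaus_normal (p : ℕ) [Fact p.Prime] (G : Type*)
    [Group G] [TopologicalSpace G] [IsTopologicalGroup G] (n : ℕ) :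
    (zassenhaus p G n).Normal where
  conj_mem x hx g :=
    zassenhaus_le_comap p (MulAut.conj g).toMonoidHom
      (by
        change Continuous fun x => g * x * g⁻¹
        fun_prop) n hx

instance zassenhaus_sigmaInvariant (p : ℕ) [Fact p.Prime] (G : Type*)
    [Group G] [TopologicalSpace G] [IsTopologicalGroup G] [SigmaGroup G] (n : ℕ) :
    SigmaInvariant (zassenhaus p G n) where
  sigma_mem _ hx := zassenhaus_le_comap p sigma continuous_sigma n hx

/-- `H¹(G, 𝔽_p)` for the trivial action of `G` on `𝔽_p`: the continuous `1`-cocycles are the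
continuous homomorphisms `G → 𝔽_p`, and the `1`-coboundaries vanish. -/
def H1 (p : ℕ) [Fact p.Prime] (G : Type*) [Group G] [TopologicalSpace G] :
    Submodule (ZMod p) (G → ZMod p) where
  carrier := {f | Continuous f ∧ ∀ g h, f (g * h) = f g + f h}
  zero_mem' := ⟨continuous_const, by simp⟩
  add_mem' := by
    rintro a b ⟨ha, ha'⟩ ⟨hb, hb'⟩
    refine ⟨ha.add hb, fun g h => ?_⟩
    simp only [Pi.add_apply, ha', hb']
    ring
  smul_mem' := by
    rintro c a ⟨ha, ha'⟩
    refine ⟨ha.const_smul c, fun g h => ?_⟩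
    simp only [Pi.smul_apply, ha', smul_add]

/-- `d_G = dim H¹(G, 𝔽_p)`, the minimal number of generators of a finitely generated
pro-`p`-group `G`. -/
def generatorRank (p : ℕ) [Fact p.Prime] (G : Type*) [Group G] [TopologicalSpace G] : ℕ :=
  Module.finrank (ZMod p) (H1 p G)

/-! ### The free pro-`p`-group on `n` odd generators -/

/-- Normal subgroups of `p`-power index of the abstract free group on `n` letters. -/
def PIndex (p n : ℕ) : Type :=
  {N : Subgroup (FreeGroup (Fin n)) // N.Normal ∧ ∃ k, N.index = p ^ k}

instance (p n : ℕ) (N : PIndex p n) : N.1.Normal := N.2.1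

/-- The finite discrete `p`-group attached to a normal subgroup of `p`-power index. -/
def PQuot {p n : ℕ} (N : PIndex p n) : Type := FreeGroup (Fin n) ⧸ N.1

instance {p n : ℕ} (N : PIndex p n) : Group (PQuot N) :=
  inferInstanceAs (Group (FreeGroup (Fin n) ⧸ N.1))

instance {p n : ℕ} (N : PIndex p n) : TopologicalSpace (PQuot N) := ⊥

instance {p n : ℕ} (N : PIndex p n) : DiscreteTopology (PQuot N) := ⟨rfl⟩

instance {p n : ℕ} [hp : Fact p.Prime] (N : PIndex p n) : Finite (PQuot N) := by
  obtain ⟨k, hk⟩ := N.2.2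
  have : N.1.FiniteIndex := ⟨by rw [hk]; exact pow_ne_zero _ hp.out.ne_zero⟩
  exact inferInstanceAs (Finite (FreeGroup (Fin n) ⧸ N.1))

/-- The homomorphism of quotients induced by an endomorphism of the free group. -/
def PQuot.map {p n : ℕ} (M N : PIndex p n) (f : FreeGroup (Fin n) →* FreeGroup (Fin n))
    (h : ∀ w ∈ M.1, f w ∈ N.1) : PQuot M →* PQuot N :=
  QuotientGroup.map M.1 N.1 f h

/-- Compatible families, as a subgroup of the product of all quotients of `p`-power order. -/
def compatible (p n : ℕ) : Subgroup (∀ N : PIndex p n, PQuot N) where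
  carrier := {a | ∀ (M N : PIndex p n) (h : ∀ w ∈ M.1, w ∈ N.1),
    PQuot.map M N (MonoidHom.id _) h (a M) = a N}
  one_mem' := by
    intro M N h
    simp
  mul_mem' := by
    intro a b ha hb M N h
    simp [ha M N h, hb M N h]
  inv_mem' := by
    intro a ha M N h
    simp [ha M N h]

/-- The free pro-`p`-group `F_n` on `n` generators: the inverse limit of all quotients of
`p`-power order of the abstract free group on `n` letters. -/
def FreeProP (p n : ℕ) : Type := compatible p n

instance (p n : ℕ) : Group (FreeProP p n) := inferInstanceAs (Group (compatible p n))

instance (p n : ℕ) : TopologicalSpace (FreeProP p n) :=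
  inferInstanceAs (TopologicalSpace (compatible p n))

instance (p n : ℕ) : IsTopologicalGroup (FreeProP p n) :=
  inferInstanceAs (IsTopologicalGroup (compatible p n))

instance (p n : ℕ) : T2Space (FreeProP p n) :=
  inferInstanceAs (T2Space (compatible p n))

instance (p n : ℕ) : TotallyDisconnectedSpace (FreeProP p n) :=
  inferInstanceAs (TotallyDisconnectedSpace (compatible p n))

instance (p n : ℕ) [Fact p.Prime] : CompactSpace (FreeProP p n) := by
  have hc : IsClosed (compatible p n : Set (∀ N : PIndex p n, PQuot N)) := by
    have : (compatible p n : Set (∀ N : PIndex p n, PQuot N)) =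
        ⋂ (M : PIndex p n) (N : PIndex p n) (h : ∀ w ∈ M.1, w ∈ N.1),
          {a | PQuot.map M N (MonoidHom.id _) h (a M) = a N} := by
      ext a
      simp [compatible]
    rw [this]
    refine isClosed_iInter fun M => isClosed_iInter fun N => isClosed_iInter fun h => ?_
    exact isClosed_eq (continuous_of_discreteTopology.comp (continuous_apply M))
      (continuous_apply N)
  exact isCompact_iff_compactSpace.1 hc.isCompact

instance (p n : ℕ) : MeasurableSpace (FreeProP p n) := borel _

instance (p n : ℕ) : BorelSpace (FreeProP p n) := ⟨rfl⟩

/-- The automorphism of the abstract free group inverting each free generator. -/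
def freeSigma (n : ℕ) : FreeGroup (Fin n) →* FreeGroup (Fin n) :=
  FreeGroup.lift fun i => (FreeGroup.of i)⁻¹

theorem freeSigma_freeSigma (n : ℕ) (w : FreeGroup (Fin n)) :
    freeSigma n (freeSigma n w) = w := by
  have : (freeSigma n).comp (freeSigma n) = MonoidHom.id _ := by
    ext i
    simp [freeSigma]
  exact DFunLike.congr_fun this w

/-- The preimage under `freeSigma` of a normal subgroup of `p`-power index. -/
def PIndex.comapSigma {p n : ℕ} (N : PIndex p n) : PIndex p n :=
  ⟨N.1.comap (freeSigma n), inferInstance, by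
    rw [Subgroup.index_comap_of_surjective _
      (fun w => ⟨freeSigma n w, freeSigma_freeSigma n w⟩)]
    exact N.2.2⟩

/-- The action of `σ` on `F_n`, which makes the free generators odd. -/
instance freeProPSigma (p n : ℕ) : SigmaGroup (FreeProP p n) where
  sigma :=
    { toFun := fun a => ⟨fun N => PQuot.map N.comapSigma N (freeSigma n) (fun _ hw => hw)
          (a.1 N.comapSigma), by
        intro M N h
        have ha := a.2 M.comapSigma N.comapSigma (fun w hw => h _ hw)
        obtain ⟨w, hw⟩ := QuotientGroup.mk_surjective (a.1 M.comapSigma)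
        beta_reduce
        rw [← ha, ← hw]
        rfl⟩
      map_one' := by
        apply Subtype.ext
        funext N
        exact map_one _
      map_mul' := by
        intro a b
        apply Subtype.ext
        funext N
        exact map_mul _ _ _ }
  sigma_sigma := by
    intro a
    apply Subtype.ext
    funext N
    have h : ∀ w ∈ N.comapSigma.comapSigma.1, w ∈ N.1 := by
      intro w hw
      have hw' : freeSigma n (freeSigma n w) ∈ N.1 := hw
      rwa [freeSigma_freeSigma] at hw'
    have ha := a.2 N.comapSigma.comapSigma N h
    obtain ⟨w, hw⟩ := QuotientGroup.mk_surjective (a.1 N.comapSigma.comapSigma)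
    change PQuot.map _ _ _ _ (PQuot.map _ _ _ _ (a.1 N.comapSigma.comapSigma)) = a.1 N
    rw [← ha, ← hw]
    change ((freeSigma n (freeSigma n w) : FreeGroup (Fin n)) : FreeGroup (Fin n) ⧸ N.1) =
      ((w : FreeGroup (Fin n)) : FreeGroup (Fin n) ⧸ N.1)
    rw [freeSigma_freeSigma]
  continuous_sigma := by
    refine Continuous.subtype_mk (continuous_pi fun N => ?_) _
    exact continuous_of_discreteTopology.comp
      ((continuous_apply N.comapSigma).comp continuous_subtype_val)

/-- The free generators `x_1, …, x_n` of `F_n`. -/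
def FreeProP.gen (p : ℕ) {n : ℕ} (i : Fin n) : FreeProP p n :=
  ⟨fun N => (QuotientGroup.mk (FreeGroup.of i) : FreeGroup (Fin n) ⧸ N.1), fun _ _ _ => rfl⟩

theorem FreeProP.gen_odd (p : ℕ) {n : ℕ} (i : Fin n) :
    FreeProP.gen p i ∈ oddPart (FreeProP p n) := by
  apply Subtype.ext
  funext N
  change ((freeSigma n (FreeGroup.of i) : FreeGroup (Fin n)) : FreeGroup (Fin n) ⧸ N.1) =
    (((FreeGroup.of i)⁻¹ : FreeGroup (Fin n)) : FreeGroup (Fin n) ⧸ N.1)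
  simp [freeSigma]

theorem FreeProP.isPGroup_quotient (p n : ℕ) [Fact p.Prime] (N : Subgroup (FreeProP p n))
    [N.Normal] (hN : IsOpen (N : Set (FreeProP p n))) : IsPGroup p (FreeProP p n ⧸ N) := by
  obtain ⟨V, hV, hVN⟩ := isOpen_induced_iff.1 hN
  have h1 : (1 : ∀ M : PIndex p n, PQuot M) ∈ V := by
    exact (Set.ext_iff.1 hVN (1 : FreeProP p n)).2 N.one_mem
  obtain ⟨I, u, hu, hIV⟩ := isOpen_pi_iff.1 hV _ h1
  intro x
  induction x using QuotientGroup.induction_on with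
  | H a =>
    have hk : ∀ M : PIndex p n, ∃ k, (a.1 M) ^ p ^ k = 1 := by
      intro M
      obtain ⟨k, hk⟩ := M.2.2
      refine ⟨k, ?_⟩
      rw [← hk]
      exact pow_card_eq_one' (G := FreeGroup (Fin n) ⧸ M.1)
    choose k hk using hk
    refine ⟨∑ M ∈ I, k M, ?_⟩
    rw [← QuotientGroup.mk_pow, QuotientGroup.eq_one_iff]
    have : (a ^ p ^ (∑ M ∈ I, k M)).1 ∈ V := by
      apply hIV
      intro M hM
      have hdvd : p ^ k M ∣ p ^ (∑ M ∈ I, k M) :=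
        pow_dvd_pow _ (Finset.single_le_sum (fun _ _ => Nat.zero_le _) hM)
      obtain ⟨c, hc⟩ := hdvd
      have : (a ^ p ^ (∑ M ∈ I, k M)).1 M = 1 := by
        change (a.1 M) ^ p ^ (∑ M ∈ I, k M) = 1
        rw [hc, pow_mul, hk, one_pow]
      rw [this]
      exact (hu M hM).2
    exact (Set.ext_iff.1 hVN _).1 this

/-! ### The Haar measure on the odd part -/

/-- The defining property of the Haar measure on `G⁻`: total measure one, and for every
`σ`-invariant open normal subgroup `N` all fibres of `G⁻ → (G/N)⁻` have equal measure. -/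
def IsOddHaar {G : Type*} [Group G] [TopologicalSpace G] [SigmaGroup G] [MeasurableSpace G]
    (ν : Measure (oddPart G)) : Prop :=
  IsProbabilityMeasure ν ∧
    ∀ (N : Subgroup G) [N.Normal] [SigmaInvariant N], IsOpen (N : Set G) →
      ∀ b ∈ oddPart (G ⧸ N),
        ν {x | ((x : G) : G ⧸ N) = b} = (Nat.card (oddPart (G ⧸ N)) : ℝ≥0∞)⁻¹

theorem exists_isOddHaar {G : Type*} [Group G] [TopologicalSpace G] [IsTopologicalGroup G]
    [SigmaGroup G] [CompactSpace G] [MeasurableSpace G] [BorelSpace G]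
    (hG : ∀ (N : Subgroup G) [N.Normal], IsOpen (N : Set G) → Odd (Nat.card (G ⧸ N))) :
    ∃ ν : Measure (oddPart G), IsOddHaar ν := by
  let K : TopologicalSpace.PositiveCompacts G := ⊤
  let μ : Measure G := Measure.haarMeasure K
  have hμ1 : μ Set.univ = 1 := Measure.haarMeasure_self (K₀ := K)
  have hμ : IsProbabilityMeasure μ := ⟨hμ1⟩
  have hmem : ∀ g : G, g * (sigma g)⁻¹ ∈ oddPart G := by
    intro g
    change sigma (g * (sigma g)⁻¹) = (g * (sigma g)⁻¹)⁻¹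
    simp [sigma_sigma]
  let t : G → oddPart G := fun g => ⟨g * (sigma g)⁻¹, hmem g⟩
  have ht : Continuous t :=
    Continuous.subtype_mk (continuous_id.mul continuous_sigma.inv) _
  refine ⟨μ.map t, Measure.isProbabilityMeasure_map ht.measurable.aemeasurable, ?_⟩
  intro N _ _ hN
  have hdisc : DiscreteTopology (G ⧸ N) := QuotientGroup.discreteTopology hN
  have hfin : Finite (G ⧸ N) := finite_of_compact_of_discrete
  let E : Set G := {g | (g : G ⧸ N) = ((sigma g : G) : G ⧸ N)}
  let A : (G ⧸ N) → Set (oddPart G) := fun b => {x | ((x : G) : G ⧸ N) = b}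
  have hA : ∀ b, MeasurableSet (A b) := by
    intro b
    have : IsOpen (A b) := (isOpen_discrete ({b} : Set (G ⧸ N))).preimage
      (QuotientGroup.continuous_mk.comp continuous_subtype_val)
    exact this.measurableSet
  have key : ∀ b ∈ oddPart (G ⧸ N), μ.map t (A b) = μ E := by
    intro b hb
    have hb' : sigma b = b⁻¹ := hb
    obtain ⟨k, hk⟩ := hG N hN
    obtain ⟨h, hh⟩ := QuotientGroup.mk_surjective (b ^ (k + 1))
    have hbb : (h : G ⧸ N) * (((sigma h : G) : G ⧸ N))⁻¹ = b := by
      rw [← sigma_mk, hh, map_pow, hb', inv_pow, inv_inv, ← pow_add]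
      have : b ^ (2 * k + 1) = 1 := by
        rw [← hk]
        exact pow_card_eq_one'
      calc b ^ (k + 1 + (k + 1)) = b ^ (2 * k + 1) * b := by
            rw [← pow_succ]
            congr 1
            omega
        _ = b := by rw [this, one_mul]
    rw [Measure.map_apply ht.measurable (hA b)]
    have : t ⁻¹' (A b) = (fun g => h⁻¹ * g) ⁻¹' E := by
      ext g
      change (((g * (sigma g)⁻¹ : G) : G ⧸ N) = b) ↔
        (((h⁻¹ * g : G) : G ⧸ N) = ((sigma (h⁻¹ * g) : G) : G ⧸ N))
      rw [← hbb]
      simp only [map_mul, map_inv, QuotientGroup.mk_mul, QuotientGroup.mk_inv]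
      rw [mul_inv_eq_iff_eq_mul, inv_mul_eq_iff_eq_mul, mul_assoc]
    rw [this, measure_preimage_mul]
  intro b hb
  change μ.map t (A b) = _
  have hsum : (Nat.card (oddPart (G ⧸ N)) : ℝ≥0∞) * μ E = 1 := by
    have hfo : Fintype (oddPart (G ⧸ N)) := Fintype.ofFinite _
    have hU : (⋃ b : oddPart (G ⧸ N), A b) = Set.univ := by
      ext x
      simp only [Set.mem_iUnion, Set.mem_univ, iff_true]
      refine ⟨⟨((x : G) : G ⧸ N), ?_⟩, rfl⟩
      change ((sigma (x : G) : G) : G ⧸ N) = (((x : G)⁻¹ : G) : G ⧸ N)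
      have hx : sigma (x : G) = (x : G)⁻¹ := x.2
      rw [hx]
    have h1 : μ.map t Set.univ = 1 := by
      rw [Measure.map_apply ht.measurable MeasurableSet.univ, Set.preimage_univ, hμ1]
    have hd : Pairwise (Function.onFun Disjoint fun b : oddPart (G ⧸ N) => A b) := by
      intro a c hac
      refine Set.disjoint_left.2 fun x hx hx' => hac (Subtype.ext ?_)
      exact Eq.trans (Eq.symm hx) hx'
    rw [← hU, measure_iUnion hd (fun b => hA b), tsum_fintype,
      Finset.sum_congr rfl (fun (c : oddPart (G ⧸ N)) _ => key c.1 c.2)] at h1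
    rw [← h1]
    simp [Nat.card_eq_fintype_card]
  rw [key b hb]
  exact ENNReal.eq_inv_of_mul_eq_one_left (by rwa [mul_comm])

open Classical in
/-- The Haar measure on `F_n⁻`. -/
def oddHaar (p n : ℕ) [Fact p.Prime] : Measure (oddPart (FreeProP p n)) :=
  if h : ∃ ν : Measure (oddPart (FreeProP p n)), IsOddHaar ν then h.choose else 0

/-- For odd `p` the measure `oddHaar p n` has the defining property of the Haar measure. -/
theorem isOddHaar_oddHaar (p n : ℕ) [hp : Fact p.Prime] (hp2 : 2 < p) :
    IsOddHaar (oddHaar p n) := by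
  have h : ∃ ν : Measure (oddPart (FreeProP p n)), IsOddHaar ν := by
    refine exists_isOddHaar fun N _ hN => ?_
    have hdisc : DiscreteTopology (FreeProP p n ⧸ N) := QuotientGroup.discreteTopology hN
    have hfin : Finite (FreeProP p n ⧸ N) := finite_of_compact_of_discrete
    obtain ⟨k, hk⟩ := IsPGroup.iff_card.1 (FreeProP.isPGroup_quotient p n N hN)
    rw [hk]
    exact (hp.out.odd_of_ne_two (by omega)).pow
  rw [oddHaar, dif_pos h]
  exact h.choose_spec

/-! ### Weak Schur `σ`-groups -/

/-- The closed normal subgroup `N_r` of `F_n` generated by all conjugates of `r_1, …, r_n`. -/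
def relSubgroup {p n : ℕ} (r : Fin n → oddPart (FreeProP p n)) : Subgroup (FreeProP p n) :=
  (Subgroup.normalClosure (Set.range fun i => (r i : FreeProP p n))).topologicalClosure

instance {p n : ℕ} (r : Fin n → oddPart (FreeProP p n)) : (relSubgroup r).Normal :=
  Subgroup.is_normal_topologicalClosure _

instance {p n : ℕ} (r : Fin n → oddPart (FreeProP p n)) : SigmaInvariant (relSubgroup r) where
  sigma_mem := by
    have hs : Function.Surjective (sigma : FreeProP p n →* FreeProP p n) :=
      fun g => ⟨sigma g, sigma_sigma g⟩
    have h : relSubgroup r ≤ (relSubgroup r).comap sigma := by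
      refine Subgroup.topologicalClosure_minimal _ ?_
        ((Subgroup.isClosed_topologicalClosure _).preimage continuous_sigma)
      have : ((relSubgroup r).comap sigma).Normal := inferInstance
      refine Subgroup.normalClosure_le_normal ?_
      rintro _ ⟨i, rfl⟩
      change sigma (r i : FreeProP p n) ∈ relSubgroup r
      have hi : sigma (r i : FreeProP p n) = (r i : FreeProP p n)⁻¹ := (r i).2
      rw [hi]
      exact inv_mem (Subgroup.le_topologicalClosure _
        (Subgroup.subset_normalClosure ⟨i, rfl⟩))
    exact fun g hg => h hg

/-- The weak Schur `σ`-group `G_r = F_n / N_r`. -/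
abbrev SchurGroup {p n : ℕ} (r : Fin n → oddPart (FreeProP p n)) : Type :=
  FreeProP p n ⧸ relSubgroup r

/-- All pairs consisting of `n ≥ 0` and a tuple `r ∈ (F_n⁻)ⁿ`. -/
abbrev SchurData (p : ℕ) : Type := Σ n : ℕ, Fin n → oddPart (FreeProP p n)

/-- The relation `G_r ≅ G_s` (`σ`-isomorphism). -/
instance schurSetoid (p : ℕ) : Setoid (SchurData p) where
  r a b := SigmaIso (SchurGroup a.2) (SchurGroup b.2)
  iseqv :=
    { refl := fun _ => ⟨ContinuousMulEquiv.refl _, fun _ => rfl⟩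
      symm := by
        rintro a b ⟨e, he⟩
        refine ⟨e.symm, fun g => e.injective ?_⟩
        rw [he]
        simp
      trans := by
        rintro a b c ⟨e, he⟩ ⟨f, hf⟩
        refine ⟨e.trans f, fun g => ?_⟩
        change f (e (sigma g)) = sigma (f (e g))
        rw [he, hf] }

/-- The set `Sch` of `σ`-isomorphism classes of weak Schur `σ`-groups. -/
def Sch (p : ℕ) : Type := Quotient (schurSetoid p)

/-- The map `Θ_n : (F_n⁻)ⁿ → Sch`, `r ↦ [G_r]`. -/
def Theta (p n : ℕ) (r : Fin n → oddPart (FreeProP p n)) : Sch p :=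
  Quotient.mk (schurSetoid p) ⟨n, r⟩

/-- The set `U_{i,G}` of all `[H]` with `H / D_i(H) ≅ G / D_i(G)`, where `G = G_a`. -/
def basicOpen (p : ℕ) [Fact p.Prime] (i : ℕ) (a : SchurData p) : Set (Sch p) :=
  {x | ∃ b : SchurData p, Theta p b.1 b.2 = x ∧
    SigmaIso (SchurGroup b.2 ⧸ zassenhaus p (SchurGroup b.2) i)
      (SchurGroup a.2 ⧸ zassenhaus p (SchurGroup a.2) i)}

/-- The topology on `Sch` generated by the sets `U_{i,G}` for `i ≥ 2`. -/
instance (p : ℕ) [Fact p.Prime] : TopologicalSpace (Sch p) :=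
  TopologicalSpace.generateFrom {U | ∃ i, 2 ≤ i ∧ ∃ a : SchurData p, U = basicOpen p i a}

instance (p : ℕ) [Fact p.Prime] : MeasurableSpace (Sch p) := borel _

instance (p : ℕ) [Fact p.Prime] : BorelSpace (Sch p) := ⟨rfl⟩

/-- The subset `Sch_m` of all `[G]` with `d_G = m`. -/
def SchEq (p : ℕ) [Fact p.Prime] (m : ℕ) : Set (Sch p) :=
  {x | ∃ a : SchurData p, Theta p a.1 a.2 = x ∧ generatorRank p (SchurGroup a.2) = m}

/-- The measure `μ_n` on `Sch`: the pushforward under `Θ_n` of the `n`-fold product of the Haar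
measure on `F_n⁻`. -/
def schMeasure (p n : ℕ) [Fact p.Prime] : Measure (Sch p) :=
  (Measure.pi fun _ : Fin n => oddHaar p n).map (Theta p n)

/-- `C_k = ∏_{i=1}^k (1 - p^{-i})`. -/
def constC (p k : ℕ) : ℝ := ∏ i ∈ Finset.range k, (1 - ((p : ℝ) ^ (i + 1))⁻¹)

/-- `C_∞ = ∏_{i≥1} (1 - p^{-i})`. -/
def constCInf (p : ℕ) : ℝ := ∏' i : ℕ, (1 - ((p : ℝ) ^ (i + 1))⁻¹)

/-- The infinite product defining `C_∞` converges. -/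
theorem multipliable_constCInf (p : ℕ) (hp : 2 < p) :
    Multipliable fun i : ℕ => (1 - ((p : ℝ) ^ (i + 1))⁻¹) := by
  have h1 : (1 : ℝ) < p := by exact_mod_cast (by omega : 1 < p)
  have hs : Summable fun i : ℕ => -((p : ℝ) ^ (i + 1))⁻¹ := by
    refine Summable.neg ?_
    have h := (summable_geometric_of_lt_one (inv_nonneg.2 (by linarith))
      (inv_lt_one_of_one_lt₀ h1)).mul_left ((p : ℝ)⁻¹)
    refine h.congr fun i => ?_
    rw [pow_succ, mul_inv, inv_pow, mul_comm]
  simpa only [sub_eq_add_neg] using Real.multipliable_one_add_of_summable hs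

end

/-!
The exponents modulo `p` of a tuple `r ∈ (F_n⁻)ⁿ` form a matrix `M(r)` over `𝔽_p`, which is
uniformly distributed, and `d_{G_r}` is the corank of `M(r)` (`generatorRank_schurGroup`), because
the characters of order `p` of `G_r` are the linear forms in the exponents that vanish on `r`.

The core of the proof compares `μ_n` and `μ_m` on `Sch_m` (`measure_expVec_inter_Theta`). Fix a
matrix `M` of corank `m`, and relations `r_j`, for `j` in a set `J` indexing a basis of the row
space of `M`. By the Frattini argument (`FreeProP.lift_surjective`) and the Hopf property
(`FreeProP.lift_injective`), the `r_j` are part of a system of `n` odd free generators of `F_n`, so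
dividing them out gives a `σ`-equivariant surjection `ψ : F_n → F_m`
(`FreeProP.exists_quotient_hom`), and `G_r` is the quotient of `F_m` by the images of the other
`m` relations (`sigmaIso_schurGroup_of_quotient_hom`). The map `ψ` carries Haar measure to Haar
measure (`FreeProP.measurePreserving_oddMap`). Moreover the transformations `x ↦ s x s`, with `s`
odd in the kernel of `ψ`, preserve the Haar measure and permute transitively the classes modulo the
Frattini subgroup allowed by `M` (`FreeProP.measure_expVec_inter_preimage`). Hence, given
`M(r) = M`, the images of the remaining relations are `m` independent random odd elements of the
Frattini subgroup of `F_m`. This describes exactly `μ_m` restricted to `Sch_m`, whatever `M` is. So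
`μ_n` is a multiple of `μ_m` on `Sch_m`, and counting the matrices of corank `m`
(`rankCount_corank`) gives the factor `C_n² / (C_m² C_{n-m})` (`schMeasure_eq_mul`), with limit
`C_∞ / C_m²`.

Since the sets `Sch_m` form a countable measurable partition of `Sch`, dominated convergence for
the sum over `m` yields the convergence of `μ_n(A)` for all Borel sets `A`, and for `A = Sch` it
shows that the limit has total mass one (`tendsto_schMeasure`).

Measurability of `Θ_n` rests on its continuity (`continuous_Theta`): the subgroups `D_i(F_n)` are
open (`FreeProP.isOpen_zassenhaus`), and `G_r / D_i(G_r)` only depends on `r` modulo `D_i(F_n)`.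
-/

noncomputable section

open SigmaGroup

/-! ### Abstract words in the free pro-`p`-group and its universal property -/

namespace FreeProP

variable {p n : ℕ}

/-- The image in `F_n` of a word of the abstract free group. -/
def ofWord (p n : ℕ) : FreeGroup (Fin n) →* FreeProP p n where
  toFun w := ⟨fun N => (QuotientGroup.mk w : FreeGroup (Fin n) ⧸ N.1), fun _ _ _ => rfl⟩
  map_one' := rfl
  map_mul' _ _ := rfl

theorem ofWord_of (i : Fin n) : ofWord p n (FreeGroup.of i) = gen p i := rfl

/-- The projection of `F_n` to one of the finite quotients defining it. -/
def proj (N : PIndex p n) : FreeProP p n →* PQuot N where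
  toFun a := a.1 N
  map_one' := rfl
  map_mul' _ _ := rfl

theorem continuous_proj (N : PIndex p n) : Continuous (proj N) :=
  (continuous_apply N).comp continuous_subtype_val

theorem proj_surjective (N : PIndex p n) : Function.Surjective (proj N) := fun x => by
  obtain ⟨w, rfl⟩ := QuotientGroup.mk_surjective (s := N.1) x
  exact ⟨ofWord p n w, rfl⟩

theorem ext_proj {a b : FreeProP p n} (h : ∀ N, proj N a = proj N b) : a = b :=
  Subtype.ext (funext h)

theorem _root_.PIndex.exists_le_of_finset [hp : Fact p.Prime] (I : Finset (PIndex p n)) :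
    ∃ N : PIndex p n, ∀ M ∈ I, N.1 ≤ M.1 := by
  classical
  induction I using Finset.induction_on with
  | empty => exact ⟨⟨⊤, inferInstance, 0, by simp⟩, by simp⟩
  | insert M I _ ih =>
    obtain ⟨N, hN⟩ := ih
    have hnorm : (M.1 ⊓ N.1).Normal := inferInstance
    refine ⟨⟨M.1 ⊓ N.1, hnorm, ?_⟩, ?_⟩
    · obtain ⟨k, hk⟩ := M.2.2
      obtain ⟨l, hl⟩ := N.2.2
      have h1 : (M.1 ⊓ N.1).index = M.1.relIndex N.1 * N.1.index := by
        rw [← Subgroup.relIndex_mul_index (inf_le_right : M.1 ⊓ N.1 ≤ N.1),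
          Subgroup.inf_relIndex_right]
      have h2 : M.1.relIndex N.1 ∣ p ^ k := hk ▸ Subgroup.relIndex_dvd_index_of_normal M.1 N.1
      obtain ⟨j, -, hj⟩ := (Nat.dvd_prime_pow hp.out).1 h2
      exact ⟨j + l, by rw [h1, hj, hl, pow_add]⟩
    · intro L hL
      rcases Finset.mem_insert.1 hL with rfl | hL
      · exact inf_le_left
      · exact inf_le_right.trans (hN L hL)

theorem proj_eq_of_le {M N : PIndex p n} (h : N.1 ≤ M.1) {a b : FreeProP p n}
    (hab : proj N a = proj N b) : proj M a = proj M b := by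
  have ha := a.2 N M h
  have hb := b.2 N M h
  change a.1 M = b.1 M
  rw [← ha, ← hb]
  exact congrArg _ hab

/-- The cosets of the kernels of the projections form a basis of the topology of `F_n`. -/
theorem exists_proj_fibre_subset [Fact p.Prime] {U : Set (FreeProP p n)} (hU : IsOpen U)
    {a : FreeProP p n} (ha : a ∈ U) :
    ∃ N : PIndex p n, ∀ b, proj N b = proj N a → b ∈ U := by
  obtain ⟨V, hV, hVU⟩ := isOpen_induced_iff.1 hU
  have haV : a.1 ∈ V := (Set.ext_iff.1 hVU a).2 ha
  obtain ⟨I, u, hu, hIV⟩ := isOpen_pi_iff.1 hV _ haV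
  obtain ⟨N, hN⟩ := PIndex.exists_le_of_finset I
  refine ⟨N, fun b hb => (Set.ext_iff.1 hVU b).1 (hIV fun M hM => ?_)⟩
  have : b.1 M = a.1 M := proj_eq_of_le (hN M hM) hb
  rw [this]
  exact (hu M hM).2

theorem denseRange_ofWord [Fact p.Prime] : DenseRange (ofWord p n) := by
  intro a
  rw [mem_closure_iff]
  intro U hU ha
  obtain ⟨N, hN⟩ := exists_proj_fibre_subset hU ha
  obtain ⟨w, hw⟩ := QuotientGroup.mk_surjective (s := N.1) (a.1 N)
  exact ⟨ofWord p n w, hN _ hw, w, rfl⟩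

/-- A continuous homomorphism on `F_n` is determined by the images of the generators. -/
theorem hom_ext [Fact p.Prime] {T : Type*} [Group T] [TopologicalSpace T] [T2Space T]
    {f g : FreeProP p n →* T} (hf : Continuous f) (hg : Continuous g)
    (h : ∀ i, f (gen p i) = g (gen p i)) : f = g := by
  have hw : f.comp (ofWord p n) = g.comp (ofWord p n) := by
    ext i
    exact h i
  refine DFunLike.coe_injective (denseRange_ofWord.equalizer hf hg ?_)
  funext w
  exact DFunLike.congr_fun hw w

section liftFinite

variable {Q : Type*} [Group Q]

/-- The kernel of a homomorphism from the abstract free group to a finite `p`-group. -/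
def kerIndex [hp : Fact p.Prime] [Finite Q] (hQ : IsPGroup p Q) (y : Fin n → Q) :
    PIndex p n :=
  ⟨(FreeGroup.lift y).ker, inferInstance, by
    rw [Subgroup.index_ker]
    exact IsPGroup.iff_card.1 (hQ.to_subgroup _)⟩

/-- The homomorphism from `F_n` to a finite `p`-group with prescribed images of the
generators. -/
def liftFinite [hp : Fact p.Prime] [Finite Q] (hQ : IsPGroup p Q) (y : Fin n → Q) :
    FreeProP p n →* Q :=
  (QuotientGroup.kerLift (FreeGroup.lift y)).comp (proj (kerIndex hQ y))

theorem liftFinite_ofWord [hp : Fact p.Prime] [Finite Q] (hQ : IsPGroup p Q) (y : Fin n → Q)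
    (w : FreeGroup (Fin n)) : liftFinite hQ y (ofWord p n w) = FreeGroup.lift y w := rfl

theorem liftFinite_gen [hp : Fact p.Prime] [Finite Q] (hQ : IsPGroup p Q) (y : Fin n → Q)
    (i : Fin n) : liftFinite hQ y (gen p i) = y i := by
  rw [← ofWord_of, liftFinite_ofWord, FreeGroup.lift_apply_of]

theorem continuous_liftFinite [hp : Fact p.Prime] [Finite Q] [TopologicalSpace Q]
    (hQ : IsPGroup p Q) (y : Fin n → Q) : Continuous (liftFinite hQ y) := by
  have : Continuous fun x : PQuot (kerIndex hQ y) =>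
      QuotientGroup.kerLift (FreeGroup.lift y) x := continuous_of_discreteTopology
  exact this.comp (continuous_proj _)

end liftFinite

theorem _root_.PQuot.isPGroup [Fact p.Prime] (N : PIndex p n) : IsPGroup p (PQuot N) := by
  obtain ⟨k, hk⟩ := N.2.2
  exact IsPGroup.of_card hk

/-- The homomorphism `F_n → F_m` with prescribed images of the generators. -/
def lift [hp : Fact p.Prime] {m : ℕ} (y : Fin n → FreeProP p m) :
    FreeProP p n →* FreeProP p m where
  toFun a := ⟨fun N => liftFinite (PQuot.isPGroup N) (fun i => proj N (y i)) a, by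
    intro M N h
    let φ : PQuot M →* PQuot N := PQuot.map M N (MonoidHom.id _) h
    have : φ.comp (liftFinite (PQuot.isPGroup M) fun i => proj M (y i)) =
        liftFinite (PQuot.isPGroup N) fun i => proj N (y i) := by
      have hφ : Continuous φ := continuous_of_discreteTopology
      refine hom_ext (hφ.comp (continuous_liftFinite _ _))
        (continuous_liftFinite _ _) fun i => ?_
      rw [MonoidHom.comp_apply, liftFinite_gen, liftFinite_gen]
      exact (y i).2 M N h
    exact DFunLike.congr_fun this a⟩
  map_one' := ext_proj fun N =>
    map_one (liftFinite (PQuot.isPGroup N) fun i => proj N (y i))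
  map_mul' a b := ext_proj fun N =>
    map_mul (liftFinite (PQuot.isPGroup N) fun i => proj N (y i)) a b

theorem lift_gen [hp : Fact p.Prime] {m : ℕ} (y : Fin n → FreeProP p m) (i : Fin n) :
    lift y (gen p i) = y i :=
  ext_proj fun N => liftFinite_gen (PQuot.isPGroup N) (fun i => proj N (y i)) i

theorem continuous_lift [hp : Fact p.Prime] {m : ℕ} (y : Fin n → FreeProP p m) :
    Continuous (lift y) :=
  Continuous.subtype_mk (continuous_pi fun _ => continuous_liftFinite _ _) _

theorem sigma_gen (i : Fin n) : sigma (gen p i) = (gen p i)⁻¹ := gen_odd p i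

/-- A continuous homomorphism `F_n → F_m` sending the generators to odd elements is
`σ`-equivariant. -/
theorem map_sigma_of_gen_odd [hp : Fact p.Prime] {m : ℕ} {f : FreeProP p n →* FreeProP p m}
    (hf : Continuous f) (hodd : ∀ i, f (gen p i) ∈ oddPart (FreeProP p m)) (a : FreeProP p n) :
    f (sigma a) = sigma (f a) := by
  have : f.comp sigma = sigma.comp f := by
    refine hom_ext (hf.comp continuous_sigma) (continuous_sigma.comp hf) fun i => ?_
    have hi : sigma (f (gen p i)) = (f (gen p i))⁻¹ := hodd i
    simp [sigma_gen, hi]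
  exact DFunLike.congr_fun this a

/-! ### Exponents modulo `p` -/

theorem isPGroup_multiplicative_pi [hp : Fact p.Prime] (ι : Type*) :
    IsPGroup p (Multiplicative (ι → ZMod p)) := by
  intro g
  refine ⟨1, Multiplicative.toAdd.injective ?_⟩
  rw [toAdd_pow, pow_one, toAdd_one]
  funext i
  simp

/-- The exponents modulo `p` of the generators in an element of `F_n`, as a homomorphism
`F_n → 𝔽_p^n`. Its kernel is the Frattini subgroup `D_2(F_n)`. -/
def expHom (p n : ℕ) [hp : Fact p.Prime] : FreeProP p n →* Multiplicative (Fin n → ZMod p) :=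
  liftFinite (isPGroup_multiplicative_pi (Fin n)) fun i =>
    Multiplicative.ofAdd (Pi.single i (1 : ZMod p))

/-- The vector of exponents modulo `p` of an element of `F_n`. -/
def expVec [hp : Fact p.Prime] (a : FreeProP p n) : Fin n → ZMod p := (expHom p n a).toAdd

variable [hp : Fact p.Prime]

@[simp] theorem expVec_mul (a b : FreeProP p n) : expVec (a * b) = expVec a + expVec b := by
  simp [expVec]

@[simp] theorem expVec_one : expVec (1 : FreeProP p n) = 0 := by
  simp [expVec]

@[simp] theorem expVec_inv (a : FreeProP p n) : expVec a⁻¹ = -expVec a := by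
  simp [expVec]

@[simp] theorem expVec_pow (a : FreeProP p n) (k : ℕ) : expVec (a ^ k) = k • expVec a := by
  simp [expVec]

theorem expVec_gen (i : Fin n) : expVec (gen p i) = Pi.single i (1 : ZMod p) := by
  simp [expVec, expHom, liftFinite_gen]

theorem continuous_expVec : Continuous (expVec : FreeProP p n → Fin n → ZMod p) := by
  have h1 : Continuous (expHom p n) := continuous_liftFinite _ _
  have h2 : Continuous (Multiplicative.toAdd : Multiplicative (Fin n → ZMod p) → _) :=
    continuous_of_discreteTopology
  exact h2.comp h1

theorem expVec_sigma (a : FreeProP p n) : expVec (sigma a) = -expVec a := by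
  have h1 : Continuous (expHom p n) := continuous_liftFinite _ _
  let inv : Multiplicative (Fin n → ZMod p) →* Multiplicative (Fin n → ZMod p) := invMonoidHom
  have hinv : Continuous inv := continuous_of_discreteTopology
  have : (expHom p n).comp sigma = inv.comp (expHom p n) := by
    refine hom_ext (h1.comp continuous_sigma) (hinv.comp h1) fun i => ?_
    simp [sigma_gen, inv]
  exact congrArg Multiplicative.toAdd (DFunLike.congr_fun this a)

/-- Every additive character `F_n → 𝔽_p` is a linear form in the exponents. -/
theorem hom_zmod_eq_sum {f : FreeProP p n → ZMod p} (hf : Continuous f)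
    (hmul : ∀ g h, f (g * h) = f g + f h) (a : FreeProP p n) :
    f a = ∑ i, f (gen p i) * expVec a i := by
  have hc : Continuous (Multiplicative.ofAdd : ZMod p → _) := continuous_of_discreteTopology
  let F : FreeProP p n →* Multiplicative (ZMod p) :=
    MonoidHom.mk' (fun a => Multiplicative.ofAdd (f a)) fun a b => by rw [hmul, ofAdd_add]
  let G : FreeProP p n →* Multiplicative (ZMod p) :=
    MonoidHom.mk' (fun a => Multiplicative.ofAdd (∑ i, f (gen p i) * expVec a i)) fun a b => by
      rw [← ofAdd_add, ← Finset.sum_add_distrib]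
      simp [mul_add]
  have : F = G := by
    refine hom_ext (hc.comp hf) (hc.comp ?_) fun i => ?_
    · exact continuous_finsetSum _ fun i _ =>
        continuous_const.mul ((continuous_apply i).comp continuous_expVec)
    · change Multiplicative.ofAdd _ = Multiplicative.ofAdd _
      simp [expVec_gen, Pi.single_apply]
  exact congrArg Multiplicative.toAdd (DFunLike.congr_fun this a)

end FreeProP

/-! ### Generating systems: the Frattini argument and the Hopf property -/

/-- A proper subgroup of a finite `p`-group lies in the kernel of a nontrivial character of
order `p`, because a maximal subgroup containing it is normal with simple quotient. -/
theorem IsPGroup.exists_hom_zmod_of_ne_top {p : ℕ} [hp : Fact p.Prime] {Q : Type*} [Group Q]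
    [Finite Q] (hQ : IsPGroup p Q) {K : Subgroup Q} (hK : K ≠ ⊤) :
    ∃ f : Q →* Multiplicative (ZMod p), K ≤ f.ker ∧ f ≠ 1 := by
  obtain ⟨H, hH, hKH⟩ := (eq_top_or_exists_le_coatom K).resolve_left hK
  have hnil : Group.IsNilpotent Q := hQ.isNilpotent
  have hnorm : H.Normal :=
    Subgroup.NormalizerCondition.normal_of_coatom H Group.normalizerCondition_of_isNilpotent hH
  have hpQ : IsPGroup p (Q ⧸ H) := hQ.to_quotient H
  obtain ⟨a, ha⟩ : ∃ a, a ∉ H := by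
    by_contra h
    push Not at h
    exact hH.1 (eq_top_iff.2 fun x _ => h x)
  have hnt : Nontrivial (Q ⧸ H) :=
    ⟨(a : Q ⧸ H), 1, fun h => ha ((QuotientGroup.eq_one_iff a).1 h)⟩
  obtain ⟨k, hk0, hk⟩ := (IsPGroup.nontrivial_iff_card hpQ).1 hnt
  obtain ⟨g, hg⟩ := exists_prime_orderOf_dvd_card' (G := Q ⧸ H) p
    (hk ▸ dvd_pow_self p hk0.ne')
  have hne : g ≠ 1 := by
    rintro rfl
    rw [orderOf_one] at hg
    exact hp.out.one_lt.ne hg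
  have htop : Subgroup.zpowers g = ⊤ := by
    have hle : H ≤ (Subgroup.zpowers g).comap (QuotientGroup.mk' H) := fun x hx => by
      have : QuotientGroup.mk' H x = 1 := (QuotientGroup.eq_one_iff x).2 hx
      rw [Subgroup.mem_comap, this]
      exact one_mem _
    rcases hH.le_iff.1 hle with h | h
    · refine eq_top_iff.2 fun x _ => ?_
      obtain ⟨b, rfl⟩ := QuotientGroup.mk'_surjective H x
      have : b ∈ (Subgroup.zpowers g).comap (QuotientGroup.mk' H) := h ▸ Subgroup.mem_top b
      exact this
    · obtain ⟨b, rfl⟩ := QuotientGroup.mk'_surjective H g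
      have : b ∈ H := h ▸ (Subgroup.mem_zpowers _ : b ∈ Subgroup.comap _ _)
      exact absurd ((QuotientGroup.eq_one_iff b).2 this) hne
  have hcard : Nat.card (Q ⧸ H) = p := by
    rw [← hg, ← Nat.card_zpowers, htop, Subgroup.card_top]
  let e : Q ⧸ H ≃* Multiplicative (ZMod p) := mulEquivOfPrimeCardEq hcard (by simp)
  refine ⟨e.toMonoidHom.comp (QuotientGroup.mk' H), fun x hx => ?_, fun h => ha ?_⟩
  · have : QuotientGroup.mk' H x = 1 := (QuotientGroup.eq_one_iff x).2 (hKH hx)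
    rw [MonoidHom.mem_ker, MonoidHom.comp_apply, this, map_one]
  · have : e (QuotientGroup.mk' H a) = 1 := DFunLike.congr_fun h a
    exact (QuotientGroup.eq_one_iff a).1 (e.map_eq_one_iff.1 this)

namespace FreeProP

variable {p n : ℕ} [hp : Fact p.Prime]

/-- Elements whose exponent vectors span `𝔽_p^n` generate `F_n` topologically. -/
theorem lift_surjective {k : ℕ} {y : Fin k → FreeProP p n}
    (hy : Submodule.span (ZMod p) (Set.range fun i => expVec (y i)) = ⊤) :
    Function.Surjective (lift y) := by
  have hproj : ∀ N : PIndex p n, ((proj N).comp (lift y)).range = ⊤ := by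
    intro N
    by_contra hne
    obtain ⟨f, hf, hf1⟩ := (PQuot.isPGroup N).exists_hom_zmod_of_ne_top hne
    refine hf1 ?_
    have hfc : Continuous fun x : PQuot N => (f x).toAdd := continuous_of_discreteTopology
    have hsum := hom_zmod_eq_sum (f := fun a => (f (proj N a)).toAdd)
      (hfc.comp (continuous_proj N)) (fun g h => by simp)
    let L : (Fin n → ZMod p) →ₗ[ZMod p] ZMod p :=
      Fintype.linearCombination (ZMod p) fun i => (f (proj N (gen p i))).toAdd
    have hL : ∀ a, L (expVec a) = (f (proj N a)).toAdd := by
      intro a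
      rw [hsum a]
      simp [L, Fintype.linearCombination_apply, mul_comm]
    have hL0 : L = 0 := by
      refine LinearMap.ext_on_range (v := fun i => expVec (y i)) hy fun i => ?_
      rw [hL]
      have : f (proj N (y i)) = 1 := by
        refine MonoidHom.mem_ker.1 (hf ⟨gen p i, ?_⟩)
        rw [MonoidHom.comp_apply, lift_gen]
      simp [this]
    ext x
    obtain ⟨a, rfl⟩ := proj_surjective N x
    have := hL a
    rw [hL0] at this
    exact congrArg Multiplicative.ofAdd this.symm
  have hclosed : IsClosed (Set.range (lift y)) :=
    (isCompact_range (continuous_lift y)).isClosed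
  rw [← Set.range_eq_univ, ← hclosed.closure_eq, Set.eq_univ_iff_forall]
  intro a
  rw [mem_closure_iff]
  intro U hU ha
  obtain ⟨N, hN⟩ := exists_proj_fibre_subset hU ha
  obtain ⟨b, hb⟩ := (MonoidHom.range_eq_top.1 (hproj N)) (proj N a)
  exact ⟨lift y b, hN _ hb, b, rfl⟩

/-- The Hopf property of `F_n`: composition with a surjective endomorphism is injective, hence
bijective, on the finite set of homomorphisms to a given finite `p`-group. -/
theorem lift_injective {y : Fin n → FreeProP p n} (hy : Function.Surjective (lift y)) :
    Function.Injective (lift y) := by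
  intro a b hab
  refine ext_proj fun N => ?_
  let Λ : (Fin n → PQuot N) → FreeProP p n →* PQuot N := liftFinite (PQuot.isPGroup N)
  have hΛ : ∀ q, Continuous (Λ q) := fun q => continuous_liftFinite _ _
  let T : (Fin n → PQuot N) → Fin n → PQuot N := fun q i => Λ q (y i)
  have hT : Function.Injective T := by
    intro q q' h
    have h1 : (Λ q).comp (lift y) = (Λ q').comp (lift y) := by
      refine hom_ext ((hΛ q).comp (continuous_lift y)) ((hΛ q').comp (continuous_lift y))
        fun i => ?_
      rw [MonoidHom.comp_apply, MonoidHom.comp_apply, lift_gen]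
      exact congrFun h i
    funext i
    obtain ⟨c, hc⟩ := hy (gen p i)
    have h2 := DFunLike.congr_fun h1 c
    rw [MonoidHom.comp_apply, MonoidHom.comp_apply, hc] at h2
    exact (liftFinite_gen _ q i).symm.trans (h2.trans (liftFinite_gen _ q' i))
  obtain ⟨q, hq⟩ := (Finite.injective_iff_surjective.1 hT) fun i => proj N (gen p i)
  have hcomp : (Λ q).comp (lift y) = proj N := by
    refine hom_ext ((hΛ q).comp (continuous_lift y)) (continuous_proj N) fun i => ?_
    rw [MonoidHom.comp_apply, lift_gen]
    exact congrFun hq i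
  rw [← hcomp, MonoidHom.comp_apply, MonoidHom.comp_apply, hab]

/-- Given odd elements `y_1, …, y_n` whose exponent vectors span `𝔽_p^n`, the quotient of `F_n`
by the relations `y_j = 1` for `j` in a set `P` is again a free pro-`p`-group on odd
generators. -/
theorem exists_quotient_hom {m : ℕ} (P : Fin n → Prop) (e : {i // ¬ P i} ≃ Fin m)
    {y : Fin n → FreeProP p n} (hodd : ∀ i, y i ∈ oddPart (FreeProP p n))
    (hy : Submodule.span (ZMod p) (Set.range fun i => expVec (y i)) = ⊤) :
    ∃ ψ : FreeProP p n →* FreeProP p m, Continuous ψ ∧ Function.Surjective ψ ∧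
      (∀ a, ψ (sigma a) = sigma (ψ a)) ∧
      ψ.ker = (Subgroup.normalClosure
        (Set.range fun j : {j // P j} => y j)).topologicalClosure := by
  classical
  have hbij : Function.Bijective (lift y) :=
    ⟨lift_injective (lift_surjective hy), lift_surjective hy⟩
  let α : FreeProP p n ≃* FreeProP p n := MulEquiv.ofBijective (lift y) hbij
  have hαc : Continuous α := continuous_lift y
  have hαsymm : Continuous α.symm :=
    (hαc.homeoOfEquivCompactToT2 (f := α.toEquiv)).continuous_invFun
  have hα : ∀ i, α (gen p i) = y i := lift_gen y
  have hα' : ∀ i, α.symm (y i) = gen p i := fun i => by rw [← hα, α.symm_apply_apply]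
  let z : Fin n → FreeProP p m := fun i => if h : P i then 1 else gen p (e ⟨i, h⟩)
  have hz : ∀ i, z i ∈ oddPart (FreeProP p m) := by
    intro i
    by_cases h : P i
    · simp [z, h, oddPart]
    · simp only [z, h, dif_neg, not_false_eq_true]
      exact gen_odd p _
  let ψ : FreeProP p n →* FreeProP p m := (lift z).comp α.symm.toMonoidHom
  have hψc : Continuous ψ := (continuous_lift z).comp hαsymm
  have hψy : ∀ i, ψ (y i) = z i := by
    intro i
    change lift z (α.symm (y i)) = z i
    rw [hα', lift_gen]
  have hψα : ∀ a, ψ (α a) = lift z a := fun a => by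
    change lift z (α.symm (α a)) = _
    rw [α.symm_apply_apply]
  let s : FreeProP p m →* FreeProP p n := lift fun k => y (e.symm k)
  have hψs : ∀ x, ψ (s x) = x := by
    have : ψ.comp s = MonoidHom.id _ := by
      refine hom_ext (hψc.comp (continuous_lift _)) continuous_id fun k => ?_
      rw [MonoidHom.comp_apply, lift_gen, hψy]
      simp [z, (e.symm k).2]
    exact DFunLike.congr_fun this
  refine ⟨ψ, hψc, fun x => ⟨s x, hψs x⟩, ?_, le_antisymm ?_ ?_⟩
  · intro a
    obtain ⟨b, rfl⟩ := hbij.2 a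
    have h1 : lift y (sigma b) = sigma (lift y b) :=
      map_sigma_of_gen_odd (continuous_lift y) (fun i => by rw [lift_gen]; exact hodd i) b
    have h2 : lift z (sigma b) = sigma (lift z b) :=
      map_sigma_of_gen_odd (continuous_lift z) (fun i => by rw [lift_gen]; exact hz i) b
    rw [← h1]
    exact (hψα _).trans (h2.trans (congrArg _ (hψα b).symm))
  · set N := (Subgroup.normalClosure
      (Set.range fun j : {j // P j} => y j)).topologicalClosure with hN
    have hNn : N.Normal := Subgroup.is_normal_topologicalClosure _
    have hNc : IsClosed (N : Set (FreeProP p n)) := Subgroup.isClosed_topologicalClosure _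
    -- Modulo `N`, the section `s` inverts `ψ`, as one sees on the generators `y i`.
    have hcomp : ((QuotientGroup.mk' N).comp s).comp (lift z) =
        (QuotientGroup.mk' N).comp α.toMonoidHom := by
      have hmk : Continuous (QuotientGroup.mk' N) := QuotientGroup.continuous_mk
      refine hom_ext ((hmk.comp (continuous_lift _)).comp (continuous_lift _))
        (hmk.comp hαc) fun i => ?_
      change QuotientGroup.mk' N (s (lift z (gen p i))) = QuotientGroup.mk' N (α (gen p i))
      rw [lift_gen, hα]
      by_cases h : P i
      · have h1 : z i = 1 := by simp [z, h]
        rw [h1, map_one, map_one, eq_comm]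
        exact (QuotientGroup.eq_one_iff _).2 (Subgroup.le_topologicalClosure _
          (Subgroup.subset_normalClosure ⟨⟨i, h⟩, rfl⟩))
      · have h1 : z i = gen p (e ⟨i, h⟩) := by simp [z, h]
        rw [h1, lift_gen, e.symm_apply_apply]
    intro a ha
    obtain ⟨b, rfl⟩ := α.surjective a
    have hb : lift z b = 1 := by rw [← hψα]; exact ha
    have h1 : QuotientGroup.mk' N (s (lift z b)) = QuotientGroup.mk' N (α b) :=
      DFunLike.congr_fun hcomp b
    rw [hb, map_one, map_one] at h1
    exact (QuotientGroup.eq_one_iff _).1 h1.symm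
  · refine Subgroup.topologicalClosure_minimal _ (Subgroup.normalClosure_le_normal ?_) ?_
    · rintro _ ⟨j, rfl⟩
      change ψ (y j) = 1
      rw [hψy]
      simp [z, j.2]
    · exact isClosed_singleton.preimage hψc

end FreeProP

/-! ### The Haar measure on the odd part -/

instance PIndex.countable (p n : ℕ) [hp : Fact p.Prime] : Countable (PIndex p n) := by
  -- A subgroup of finite index is finitely generated, hence determined by a finite set.
  have h : ∀ N : PIndex p n, ∃ S : Finset (FreeGroup (Fin n)),
      Subgroup.closure (S : Set (FreeGroup (Fin n))) = N.1 := by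
    intro N
    obtain ⟨k, hk⟩ := N.2.2
    have : N.1.FiniteIndex := ⟨by rw [hk]; exact pow_ne_zero _ hp.out.ne_zero⟩
    exact (Group.fg_iff_subgroup_fg _).1 (Subgroup.fg_of_index_ne_zero N.1)
  choose S hS using h
  have hinj : Function.Injective S := fun M N hMN => Subtype.ext (by rw [← hS, ← hS N, hMN])
  exact hinj.countable

instance FreeProP.secondCountable (p n : ℕ) [Fact p.Prime] :
    SecondCountableTopology (FreeProP p n) :=
  have : SecondCountableTopology (∀ N : PIndex p n, PQuot N) := inferInstance
  Topology.IsInducing.subtypeVal.secondCountableTopology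

section OddFibre

variable {G : Type*} [Group G] [TopologicalSpace G] [SigmaGroup G]

/-- The fibre of `G⁻ → (G/N)⁻` over `b`. -/
def oddFibre (N : Subgroup G) (b : G ⧸ N) : Set (oddPart G) := {x | ((x : G) : G ⧸ N) = b}

theorem mk_mem_oddPart (N : Subgroup G) [N.Normal] [SigmaInvariant N] (x : oddPart G) :
    ((x : G) : G ⧸ N) ∈ oddPart (G ⧸ N) := by
  have hx : sigma (x : G) = (x : G)⁻¹ := x.2
  change sigma ((x : G) : G ⧸ N) = _
  rw [sigma_mk, hx, QuotientGroup.mk_inv]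

/-- The largest `σ`-invariant subgroup of `N`. -/
def sigmaCore (N : Subgroup G) : Subgroup G := N ⊓ N.comap sigma

instance (N : Subgroup G) [N.Normal] : (sigmaCore N).Normal :=
  inferInstanceAs (N ⊓ N.comap sigma).Normal

instance (N : Subgroup G) : SigmaInvariant (sigmaCore N) where
  sigma_mem g hg := ⟨hg.2, by
    change sigma (sigma g) ∈ N
    rw [sigma_sigma]
    exact hg.1⟩

instance (M N : Subgroup G) [SigmaInvariant M] [SigmaInvariant N] :
    SigmaInvariant (M ⊓ N) where
  sigma_mem g hg := ⟨SigmaInvariant.sigma_mem g hg.1, SigmaInvariant.sigma_mem g hg.2⟩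

theorem isOpen_sigmaCore {N : Subgroup G} (hN : IsOpen (N : Set G)) :
    IsOpen (sigmaCore N : Set G) :=
  hN.inter (hN.preimage continuous_sigma)

theorem isOpen_oddFibre [IsTopologicalGroup G] {N : Subgroup G} (hN : IsOpen (N : Set G))
    (b : G ⧸ N) : IsOpen (oddFibre N b) := by
  have hdisc : DiscreteTopology (G ⧸ N) := QuotientGroup.discreteTopology hN
  exact (isOpen_discrete ({b} : Set (G ⧸ N))).preimage
    (QuotientGroup.continuous_mk.comp continuous_subtype_val)

end OddFibre

namespace FreeProP

variable {p n : ℕ} [hp : Fact p.Prime]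

theorem isTopologicalBasis_oddFibre : TopologicalSpace.IsTopologicalBasis
    {S : Set (oddPart (FreeProP p n)) | ∃ N : Subgroup (FreeProP p n),
      N.Normal ∧ SigmaInvariant N ∧ IsOpen (N : Set (FreeProP p n)) ∧
        ∃ a : oddPart (FreeProP p n), S = oddFibre N (a : FreeProP p n)} := by
  refine TopologicalSpace.isTopologicalBasis_of_isOpen_of_nhds ?_ ?_
  · rintro _ ⟨N, -, -, hN, a, rfl⟩
    exact isOpen_oddFibre hN _
  · intro x U hxU hU
    obtain ⟨V, hV, rfl⟩ := isOpen_induced_iff.1 hU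
    obtain ⟨M, hM⟩ := exists_proj_fibre_subset hV hxU
    have hker : IsOpen ((proj M).ker : Set (FreeProP p n)) :=
      (isOpen_discrete ({1} : Set (PQuot M))).preimage (continuous_proj M)
    refine ⟨oddFibre (sigmaCore (proj M).ker) (x : FreeProP p n),
      ⟨_, inferInstance, inferInstance, isOpen_sigmaCore hker, x, rfl⟩, rfl, ?_⟩
    intro y hy
    refine hM _ ?_
    have h := (QuotientGroup.eq (s := sigmaCore (proj M).ker).1 hy).1
    have h' : proj M ((y : FreeProP p n)⁻¹ * x) = 1 := h
    rwa [map_mul, map_inv, inv_mul_eq_one] at h'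

/-- A finite measure on `F_n⁻` is determined by the measures of the fibres over the finite
quotients. -/
theorem measure_oddPart_ext {μ ν : Measure (oddPart (FreeProP p n))} [IsFiniteMeasure μ]
    (h : ∀ (N : Subgroup (FreeProP p n)) [N.Normal] [SigmaInvariant N],
      IsOpen (N : Set (FreeProP p n)) → ∀ b ∈ oddPart (FreeProP p n ⧸ N),
        μ (oddFibre N b) = ν (oddFibre N b)) : μ = ν := by
  refine ext_of_generate_finite _
    ((BorelSpace.measurable_eq).trans isTopologicalBasis_oddFibre.borel_eq_generateFrom) ?_ ?_ ?_
  · rintro _ ⟨M, hMn, hMs, hM, a, rfl⟩ _ ⟨N, hNn, hNs, hN, b, rfl⟩ ⟨x, hx1, hx2⟩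
    refine ⟨M ⊓ N, inferInstance, inferInstance, hM.inter hN, x, ?_⟩
    have hx1' : ((x : FreeProP p n) : FreeProP p n ⧸ M) = (a : FreeProP p n) := hx1
    have hx2' : ((x : FreeProP p n) : FreeProP p n ⧸ N) = (b : FreeProP p n) := hx2
    ext y
    change ((y : FreeProP p n) : FreeProP p n ⧸ M) = (a : FreeProP p n) ∧
      ((y : FreeProP p n) : FreeProP p n ⧸ N) = (b : FreeProP p n) ↔
      ((y : FreeProP p n) : FreeProP p n ⧸ (M ⊓ N)) = (x : FreeProP p n)
    rw [← hx1', ← hx2', QuotientGroup.eq, QuotientGroup.eq, QuotientGroup.eq]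
    exact Iff.rfl
  · rintro _ ⟨N, hNn, hNs, hN, a, rfl⟩
    exact h N hN _ (mk_mem_oddPart N a)
  · have hs : SigmaInvariant (⊤ : Subgroup (FreeProP p n)) := ⟨fun _ _ => Subgroup.mem_top _⟩
    have hu : oddFibre (⊤ : Subgroup (FreeProP p n)) ((1 : FreeProP p n) : _ ⧸ _) =
        Set.univ := by
      refine Set.eq_univ_of_forall fun x => ?_
      exact QuotientGroup.eq.2 (Subgroup.mem_top _)
    have h1 : ((1 : FreeProP p n) : FreeProP p n ⧸ (⊤ : Subgroup (FreeProP p n))) ∈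
        oddPart (FreeProP p n ⧸ (⊤ : Subgroup (FreeProP p n))) := by
      simp [oddPart]
    have := h ⊤ isOpen_univ _ h1
    rwa [hu] at this

/-- A map of odd parts preserves the Haar measures if it pulls fibres over finite quotients
back to such fibres, with quotients having equally many odd elements. -/
theorem measurePreserving_of_oddFibre (hp2 : 2 < p) {m : ℕ}
    {T : oddPart (FreeProP p n) → oddPart (FreeProP p m)} (hT : Continuous T)
    (h : ∀ (N : Subgroup (FreeProP p m)) [N.Normal] [SigmaInvariant N],
      IsOpen (N : Set (FreeProP p m)) → ∀ b ∈ oddPart (FreeProP p m ⧸ N),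
        ∃ (M : Subgroup (FreeProP p n)) (_ : M.Normal) (_ : SigmaInvariant M),
          IsOpen (M : Set (FreeProP p n)) ∧
          Nat.card (oddPart (FreeProP p n ⧸ M)) = Nat.card (oddPart (FreeProP p m ⧸ N)) ∧
          ∃ a ∈ oddPart (FreeProP p n ⧸ M), T ⁻¹' oddFibre N b = oddFibre M a) :
    MeasurePreserving T (oddHaar p n) (oddHaar p m) := by
  obtain ⟨hprob, hfib⟩ := isOddHaar_oddHaar p n hp2
  obtain ⟨hprob', hfib'⟩ := isOddHaar_oddHaar p m hp2
  refine ⟨hT.measurable, ?_⟩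
  have : IsProbabilityMeasure ((oddHaar p n).map T) :=
    Measure.isProbabilityMeasure_map hT.measurable.aemeasurable
  refine measure_oddPart_ext fun N _ _ hN b hb => ?_
  obtain ⟨M, hM1, hM2, hM, hcard, a, ha, hTa⟩ := h N hN b hb
  rw [Measure.map_apply hT.measurable (isOpen_oddFibre hN b).measurableSet, hTa]
  exact (hfib M hM a ha).trans (hcard ▸ (hfib' N hN b hb).symm)

/-- The map of odd parts induced by a `σ`-equivariant homomorphism. -/
def oddMap {m : ℕ} (ψ : FreeProP p n →* FreeProP p m) (hσ : ∀ a, ψ (sigma a) = sigma (ψ a))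
    (x : oddPart (FreeProP p n)) : oddPart (FreeProP p m) :=
  ⟨ψ x, by
    have hx : sigma (x : FreeProP p n) = (x : FreeProP p n)⁻¹ := x.2
    change sigma (ψ x) = _
    rw [← hσ, hx, map_inv]⟩

theorem continuous_oddMap {p n m : ℕ} {ψ : FreeProP p n →* FreeProP p m} (hψ : Continuous ψ)
    (hσ : ∀ a, ψ (sigma a) = sigma (ψ a)) : Continuous (oddMap ψ hσ) :=
  Continuous.subtype_mk (hψ.comp continuous_subtype_val) _

/-- A surjective `σ`-equivariant homomorphism carries Haar measure to Haar measure. -/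
theorem measurePreserving_oddMap (hp2 : 2 < p) {m : ℕ} {ψ : FreeProP p n →* FreeProP p m}
    (hψ : Continuous ψ) (hsurj : Function.Surjective ψ)
    (hσ : ∀ a, ψ (sigma a) = sigma (ψ a)) :
    MeasurePreserving (oddMap ψ hσ) (oddHaar p n) (oddHaar p m) := by
  refine measurePreserving_of_oddFibre hp2 (continuous_oddMap hψ hσ) fun N _ _ hN b hb => ?_
  let φ : FreeProP p n →* FreeProP p m ⧸ N := (QuotientGroup.mk' N).comp ψ
  have hφ : Function.Surjective φ := (QuotientGroup.mk'_surjective N).comp hsurj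
  have hs : SigmaInvariant φ.ker := ⟨fun g hg => by
    have hg' : ψ g ∈ N := (QuotientGroup.eq_one_iff _).1 hg
    refine (QuotientGroup.eq_one_iff _).2 ?_
    rw [hσ]
    exact SigmaInvariant.sigma_mem _ hg'⟩
  have hopen : IsOpen (φ.ker : Set (FreeProP p n)) := by
    have : (φ.ker : Set (FreeProP p n)) = ψ ⁻¹' N := by
      ext g
      exact QuotientGroup.eq_one_iff _
    rw [this]
    exact hN.preimage hψ
  let E : FreeProP p n ⧸ φ.ker ≃* FreeProP p m ⧸ N :=
    QuotientGroup.quotientKerEquivOfSurjective φ hφ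
  have hEmk : ∀ g : FreeProP p n, E (g : FreeProP p n ⧸ φ.ker) = (ψ g : FreeProP p m) :=
    fun _ => rfl
  have hEσ : ∀ x, E (sigma x) = sigma (E x) := by
    intro x
    obtain ⟨g, rfl⟩ := QuotientGroup.mk_surjective x
    rw [sigma_mk, hEmk, hEmk, hσ, sigma_mk]
  have hodd : ∀ x, x ∈ oddPart (FreeProP p n ⧸ φ.ker) ↔ E x ∈ oddPart (FreeProP p m ⧸ N) := by
    intro x
    change sigma x = x⁻¹ ↔ sigma (E x) = (E x)⁻¹
    rw [← hEσ, ← map_inv, E.injective.eq_iff]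
  refine ⟨φ.ker, inferInstance, hs, hopen, ?_, E.symm b, ?_, ?_⟩
  · exact Nat.card_congr (E.toEquiv.subtypeEquiv hodd)
  · rw [hodd, E.apply_symm_apply]
    exact hb
  · ext x
    change ((ψ x : FreeProP p m) : FreeProP p m ⧸ N) = b ↔
      ((x : FreeProP p n) : FreeProP p n ⧸ φ.ker) = E.symm b
    rw [← hEmk, MulEquiv.eq_symm_apply]

/-- The transformation `x ↦ s x s` of the odd part, for an odd element `s`. It replaces
translations, which do not preserve the odd part. -/
def oddTranslate (s x : oddPart (FreeProP p n)) : oddPart (FreeProP p n) :=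
  ⟨s * x * s, by
    have hs : sigma (s : FreeProP p n) = (s : FreeProP p n)⁻¹ := s.2
    have hx : sigma (x : FreeProP p n) = (x : FreeProP p n)⁻¹ := x.2
    change sigma ((s : FreeProP p n) * x * s) = _
    rw [map_mul, map_mul, hs, hx]
    group⟩

theorem measurePreserving_oddTranslate (hp2 : 2 < p) (s : oddPart (FreeProP p n)) :
    MeasurePreserving (oddTranslate s) (oddHaar p n) (oddHaar p n) := by
  have hc : Continuous (oddTranslate s) :=
    Continuous.subtype_mk ((continuous_const.mul continuous_subtype_val).mul continuous_const) _
  refine measurePreserving_of_oddFibre hp2 hc fun N _ _ hN b hb => ?_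
  have hs : sigma ((s : FreeProP p n) : FreeProP p n ⧸ N) = ((s : FreeProP p n) : _ ⧸ N)⁻¹ :=
    mk_mem_oddPart N s
  have hb' : sigma b = b⁻¹ := hb
  refine ⟨N, inferInstance, inferInstance, hN, rfl,
    ((s : FreeProP p n) : FreeProP p n ⧸ N)⁻¹ * b * ((s : FreeProP p n) : FreeProP p n ⧸ N)⁻¹,
    ?_, ?_⟩
  · change sigma _ = _
    rw [map_mul, map_mul, map_inv, hs, hb']
    group
  · ext x
    change (((s : FreeProP p n) * x * s : FreeProP p n) : FreeProP p n ⧸ N) = b ↔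
      ((x : FreeProP p n) : FreeProP p n ⧸ N) = _
    rw [QuotientGroup.mk_mul, QuotientGroup.mk_mul, eq_mul_inv_iff_mul_eq, eq_inv_mul_iff_mul_eq,
      mul_assoc]

/-- Exponent vectors of elements of the kernel of `ψ` are twice the exponent vectors of odd
elements of the kernel. If `t` has a quarter of the given exponents, then `t (σ t)⁻¹` is odd and
has half of them. -/
theorem exists_odd_expVec (hp2 : 2 < p) {m : ℕ} {ψ : FreeProP p n →* FreeProP p m}
    (hσ : ∀ a, ψ (sigma a) = sigma (ψ a)) {W : Submodule (ZMod p) (Fin n → ZMod p)}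
    (hW : ∀ c ∈ W, ∃ t, ψ t = 1 ∧ expVec t = c) {c : Fin n → ZMod p} (hc : c ∈ W) :
    ∃ s : oddPart (FreeProP p n), ψ s = 1 ∧
      expVec (s : FreeProP p n) + expVec (s : FreeProP p n) = c := by
  have h4 : (4 : ZMod p) ≠ 0 := by
    intro h
    have h' : ((4 : ℕ) : ZMod p) = 0 := by exact_mod_cast h
    rw [ZMod.natCast_eq_zero_iff, show 4 = 2 ^ 2 by norm_num] at h'
    have := Nat.le_of_dvd (by norm_num) (hp.out.dvd_of_dvd_pow h')
    omega
  obtain ⟨t, ht1, ht⟩ := hW _ (W.smul_mem (4 : ZMod p)⁻¹ hc)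
  refine ⟨⟨t * (sigma t)⁻¹, ?_⟩, ?_, ?_⟩
  · change sigma (t * (sigma t)⁻¹) = (t * (sigma t)⁻¹)⁻¹
    simp [sigma_sigma]
  · simp [hσ, ht1]
  · simp only [expVec_mul, expVec_inv, expVec_sigma, neg_neg, ht]
    rw [← add_smul, ← add_smul, ← two_mul, ← two_mul, ← mul_assoc]
    norm_num [mul_inv_cancel₀ h4]

theorem measurableSet_expVec_eq {ι : Type*} [Fintype ι] (c : ι → Fin n → ZMod p) :
    MeasurableSet
      {r : ι → oddPart (FreeProP p n) | ∀ i, expVec (r i : FreeProP p n) = c i} := by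
  have h1 : ∀ i, MeasurableSet {x : oddPart (FreeProP p n) | expVec (x : FreeProP p n) = c i} :=
    fun i => (isClosed_eq (continuous_expVec.comp continuous_subtype_val)
      continuous_const).measurableSet
  refine MeasurableSet.congr (MeasurableSet.iInter fun i =>
    (h1 i).preimage (measurable_pi_apply i)) ?_
  ext r
  simp only [Set.mem_iInter]
  exact Iff.rfl

/-- Equidistribution of exponent vectors: let `ψ : F_n → F_m` be a surjection such that every
vector of `W` is the exponent vector of an element of the kernel. Among the tuples in `F_n⁻` with
image in `B`, which by assumption have exponent vectors in `W`, all families of exponent vectors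
in `W` are equally likely: the transformations `x ↦ s x s` with `s` odd in the kernel permute them
transitively. -/
theorem measure_expVec_inter_preimage (hp2 : 2 < p) {m : ℕ} {ι : Type*} [Fintype ι]
    {ψ : FreeProP p n →* FreeProP p m} (hψ : Continuous ψ) (hsurj : Function.Surjective ψ)
    (hσ : ∀ a, ψ (sigma a) = sigma (ψ a)) {W : Submodule (ZMod p) (Fin n → ZMod p)}
    (hW : ∀ c ∈ W, ∃ t, ψ t = 1 ∧ expVec t = c) {B : Set (ι → oddPart (FreeProP p m))}
    (hB : MeasurableSet B)
    (hBW : ∀ r : ι → oddPart (FreeProP p n), (fun i => oddMap ψ hσ (r i)) ∈ B →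
      ∀ i, expVec (r i : FreeProP p n) ∈ W)
    (c : ι → Fin n → ZMod p) (hc : ∀ i, c i ∈ W) :
    (Nat.card W : ℝ≥0∞) ^ Fintype.card ι *
      Measure.pi (fun _ : ι => oddHaar p n)
        {r | (∀ i, expVec (r i : FreeProP p n) = c i) ∧ (fun i => oddMap ψ hσ (r i)) ∈ B} =
      Measure.pi (fun _ : ι => oddHaar p m) B := by
  classical
  have hprob := (isOddHaar_oddHaar p n hp2).1
  have hprob' := (isOddHaar_oddHaar p m hp2).1
  have hmap : MeasurePreserving (fun (r : ι → oddPart (FreeProP p n)) i => oddMap ψ hσ (r i))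
      (Measure.pi fun _ => oddHaar p n) (Measure.pi fun _ => oddHaar p m) :=
    measurePreserving_pi _ _ fun _ => measurePreserving_oddMap hp2 hψ hsurj hσ
  let E : (ι → W) → Set (ι → oddPart (FreeProP p n)) := fun d =>
    {r | (∀ i, expVec (r i : FreeProP p n) = d i) ∧ (fun i => oddMap ψ hσ (r i)) ∈ B}
  have hE : ∀ d, MeasurableSet (E d) := fun d =>
    (measurableSet_expVec_eq fun i => (d i : Fin n → ZMod p)).inter (hmap.measurable hB)
  have hE0 : ∀ d, Measure.pi (fun _ : ι => oddHaar p n) (E d) =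
      Measure.pi (fun _ : ι => oddHaar p n) (E 0) := by
    intro d
    choose s hs1 hs2 using fun i => exists_odd_expVec hp2 hσ hW (d i).2
    have htr : MeasurePreserving
        (fun (r : ι → oddPart (FreeProP p n)) i => oddTranslate (s i) (r i))
        (Measure.pi fun _ => oddHaar p n) (Measure.pi fun _ => oddHaar p n) :=
      measurePreserving_pi _ _ fun i => measurePreserving_oddTranslate hp2 (s i)
    rw [← htr.measure_preimage (hE d).nullMeasurableSet]
    congr 1
    ext r
    have h1 : ∀ i, oddMap ψ hσ (oddTranslate (s i) (r i)) = oddMap ψ hσ (r i) := fun i =>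
      Subtype.ext (by simp [oddMap, oddTranslate, hs1])
    have h2 : ∀ i, expVec (oddTranslate (s i) (r i) : FreeProP p n) =
        expVec (r i : FreeProP p n) + d i := fun i => by
      rw [← hs2 i]
      simp only [oddTranslate, expVec_mul]
      abel
    simp [E, h1, h2]
  have hunion : (fun (r : ι → oddPart (FreeProP p n)) i => oddMap ψ hσ (r i)) ⁻¹' B =
      ⋃ d, E d := by
    ext r
    simp only [Set.mem_preimage, Set.mem_iUnion]
    exact ⟨fun h => ⟨fun i => ⟨_, hBW r h i⟩, fun i => rfl, h⟩, fun ⟨d, hd⟩ => hd.2⟩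
  have hdisj : Pairwise (Function.onFun Disjoint E) := by
    intro d d' hdd
    refine Set.disjoint_left.2 fun r hr hr' => hdd (funext fun i => Subtype.ext ?_)
    exact (hr.1 i).symm.trans (hr'.1 i)
  have hfinW : Fintype W := Fintype.ofFinite W
  rw [← hmap.measure_preimage hB.nullMeasurableSet, hunion, measure_iUnion hdisj hE,
    tsum_fintype, Finset.sum_congr rfl fun d _ => hE0 d, Finset.sum_const, nsmul_eq_mul,
    ← hE0 fun i => ⟨c i, hc i⟩, Finset.card_univ, Fintype.card_fun, Nat.card_eq_fintype_card,
    Nat.cast_pow]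

end FreeProP

/-! ### `σ`-isomorphisms and the Zassenhaus filtration of quotients -/

theorem SigmaIso.symm {G H : Type*} [Group G] [TopologicalSpace G] [SigmaGroup G]
    [Group H] [TopologicalSpace H] [SigmaGroup H] (h : SigmaIso G H) : SigmaIso H G := by
  obtain ⟨e, he⟩ := h
  refine ⟨e.symm, fun g => e.injective ?_⟩
  rw [he, e.apply_symm_apply, e.apply_symm_apply]

theorem SigmaIso.trans {G H K : Type*} [Group G] [TopologicalSpace G] [SigmaGroup G]
    [Group H] [TopologicalSpace H] [SigmaGroup H] [Group K] [TopologicalSpace K] [SigmaGroup K]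
    (h : SigmaIso G H) (h' : SigmaIso H K) : SigmaIso G K := by
  obtain ⟨e, he⟩ := h
  obtain ⟨f, hf⟩ := h'
  refine ⟨e.trans f, fun g => ?_⟩
  change f (e (sigma g)) = sigma (f (e g))
  rw [he, hf]

/-- Two Hausdorff quotients of a compact `σ`-group with the same kernel are `σ`-isomorphic. -/
theorem sigmaIso_of_ker_eq {G A B : Type*} [Group G] [TopologicalSpace G] [CompactSpace G]
    [SigmaGroup G] [Group A] [TopologicalSpace A] [T2Space A] [SigmaGroup A] [Group B]
    [TopologicalSpace B] [T2Space B] [SigmaGroup B] {f : G →* A} {g : G →* B}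
    (hf : Continuous f) (hg : Continuous g) (hfs : Function.Surjective f)
    (hgs : Function.Surjective g) (hfσ : ∀ x, f (sigma x) = sigma (f x))
    (hgσ : ∀ x, g (sigma x) = sigma (g x)) (hker : f.ker = g.ker) : SigmaIso A B := by
  let e : A ≃* B := ((QuotientGroup.quotientKerEquivOfSurjective f hfs).symm.trans
    (QuotientGroup.quotientMulEquivOfEq hker)).trans
      (QuotientGroup.quotientKerEquivOfSurjective g hgs)
  have he : ∀ x, e (f x) = g x := by
    intro x
    have h1 : (QuotientGroup.quotientKerEquivOfSurjective f hfs).symm (f x) =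
        (x : G ⧸ f.ker) := by
      rw [MulEquiv.symm_apply_eq]
      rfl
    change QuotientGroup.quotientKerEquivOfSurjective g hgs (QuotientGroup.quotientMulEquivOfEq
      hker ((QuotientGroup.quotientKerEquivOfSurjective f hfs).symm (f x))) = g x
    rw [h1]
    rfl
  have he' : ∀ x, e.symm (g x) = f x := fun x => by rw [← he, e.symm_apply_apply]
  have hfq : IsQuotientMap f := hf.isClosedMap.isQuotientMap hf hfs
  have hgq : IsQuotientMap g := hg.isClosedMap.isQuotientMap hg hgs
  have hc : Continuous e := hfq.continuous_iff.2 (hg.congr fun x => (he x).symm)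
  have hc' : Continuous e.symm := hgq.continuous_iff.2 (hf.congr fun x => (he' x).symm)
  refine ⟨{ e with continuous_toFun := hc, continuous_invFun := hc' }, fun a => ?_⟩
  obtain ⟨x, rfl⟩ := hfs a
  change e (sigma (f x)) = sigma (e (f x))
  rw [← hfσ, he, he, hgσ]

section Zassenhaus

variable (p : ℕ) [hp : Fact p.Prime]

theorem isClosed_zassenhaus (G : Type*) [Group G] [TopologicalSpace G] [IsTopologicalGroup G]
    (i : ℕ) : IsClosed (zassenhaus p G i : Set G) := by
  match i with
  | 0 => simp [zassenhaus]
  | 1 => simp [zassenhaus]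
  | i + 2 =>
    rw [zassenhaus]
    exact Subgroup.isClosed_topologicalClosure _

instance (G : Type*) [Group G] [TopologicalSpace G] [IsTopologicalGroup G] (i : ℕ) :
    T2Space (G ⧸ zassenhaus p G i) :=
  have : IsClosed (zassenhaus p G i : Set G) := isClosed_zassenhaus p G i
  inferInstance

theorem ceilDiv_prime_lt (i : ℕ) : (i + 2) ⌈/⌉ p < i + 2 := by
  have h2 := hp.out.two_le
  have : (i + 2) ⌈/⌉ p ≤ i + 1 := by
    rw [ceilDiv_le_iff_le_mul (by omega)]
    nlinarith
  omega

/-- The Zassenhaus filtration of a Hausdorff quotient of a compact group is the image of the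
filtration of the group. -/
theorem map_zassenhaus {G H : Type*} [Group G] [TopologicalSpace G] [IsTopologicalGroup G]
    [CompactSpace G] [Group H] [TopologicalSpace H] [IsTopologicalGroup H] [T2Space H]
    {f : G →* H} (hf : Continuous f) (hs : Function.Surjective f) (i : ℕ) :
    (zassenhaus p G i).map f = zassenhaus p H i := by
  refine le_antisymm (Subgroup.map_le_iff_le_comap.2 (zassenhaus_le_comap p f hf i)) ?_
  induction i using Nat.strong_induction_on with
  | _ i ih =>
    match i, ih with
    | 0, _ =>
      rw [zassenhaus, zassenhaus, Subgroup.map_top_of_surjective f hs]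
    | 1, _ =>
      rw [zassenhaus, zassenhaus, Subgroup.map_top_of_surjective f hs]
    | i + 2, ih =>
      have hclosed : IsClosed (((zassenhaus p G (i + 2)).map f : Subgroup H) : Set H) := by
        rw [Subgroup.coe_map]
        exact ((isClosed_zassenhaus p G _).isCompact.image hf).isClosed
      rw [zassenhaus]
      refine Subgroup.topologicalClosure_minimal _ (sup_le ?_ (iSup_le fun j => ?_)) hclosed
      · rw [Subgroup.closure_le]
        rintro _ ⟨y, hy, rfl⟩
        obtain ⟨x, hx, rfl⟩ := ih _ (ceilDiv_prime_lt p i) hy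
        refine ⟨x ^ p, ?_, map_pow f x p⟩
        rw [zassenhaus]
        exact Subgroup.le_topologicalClosure _
          (Subgroup.mem_sup_left (Subgroup.subset_closure ⟨x, hx, rfl⟩))
      · refine (Subgroup.commutator_mono (ih (j + 1) (by omega))
          (ih (i + 1 - j) (by omega))).trans ?_
        rw [← Subgroup.map_commutator]
        refine Subgroup.map_mono ?_
        conv_rhs => rw [zassenhaus]
        exact (le_sup_right.trans (Subgroup.le_topologicalClosure _)).trans' (le_iSup
          (fun j : Fin (i + 1) => ⁅zassenhaus p G (j + 1), zassenhaus p G (i + 1 - j)⁆) j)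

open scoped commutatorElement in
/-- In a group with a dense finitely generated subgroup, a closed normal subgroup that contains
the `p`-th powers and the commutators of an open subgroup of finite index has finite index. -/
theorem Subgroup.finiteIndex_of_pow_mem_of_commutator_mem {Γ G : Type*} [Group Γ] [Group.FG Γ]
    [Group G] [TopologicalSpace G] [IsTopologicalGroup G] {f : Γ →* G} (hf : DenseRange f)
    {K D : Subgroup G} [K.Normal] [K.FiniteIndex] (hK : IsOpen (K : Set G)) [D.Normal]
    (hD : IsClosed (D : Set G)) (hpow : ∀ x ∈ K, x ^ p ∈ D)
    (hcomm : ∀ x ∈ K, ∀ y ∈ K, ⁅x, y⁆ ∈ D) : D.FiniteIndex := by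
  let q : Γ →* G ⧸ D := (QuotientGroup.mk' D).comp f
  let H : Subgroup (G ⧸ D) := (K.comap f).map q
  have hKf : (K.comap f).FiniteIndex := by
    refine ⟨fun h => ?_⟩
    rw [Subgroup.index_comap] at h
    have := Subgroup.relIndex_dvd_index_of_normal K f.range
    rw [h, zero_dvd_iff] at this
    exact Subgroup.FiniteIndex.index_ne_zero this
  have hfg : Group.FG (K.comap f) := Subgroup.fg_of_index_ne_zero _
  have hHfg : Group.FG H := by
    classical
    rw [Group.fg_iff_subgroup_fg] at hfg ⊢
    obtain ⟨S, hS⟩ := hfg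
    exact ⟨S.image q, by rw [Finset.coe_image, ← MonoidHom.map_closure, hS]⟩
  have hHcomm : ∀ a b : H, a * b = b * a := by
    rintro ⟨_, x, hx, rfl⟩ ⟨_, y, hy, rfl⟩
    refine Subtype.ext ?_
    change q x * q y = q y * q x
    rw [← commutatorElement_eq_one_iff_mul_comm, ← map_commutatorElement]
    have := hcomm _ hx _ hy
    rw [← map_commutatorElement] at this
    exact (QuotientGroup.eq_one_iff _).2 this
  let _ : CommGroup H := { (inferInstance : Group H) with mul_comm := hHcomm }
  have htors : IsMulTorsion H := by
    rintro ⟨_, x, hx, rfl⟩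
    refine isOfFinOrder_iff_pow_eq_one.2 ⟨p, hp.out.pos, Subtype.ext ?_⟩
    change q x ^ p = 1
    rw [← map_pow]
    refine (QuotientGroup.eq_one_iff _).2 ?_
    rw [map_pow]
    exact hpow _ hx
  have hfin : Finite H := CommGroup.finite_of_fg_isMulTorsion H htors
  have hHclosed : IsClosed (H : Set (G ⧸ D)) := (Set.toFinite (H : Set (G ⧸ D))).isClosed
  have hKH : K.map (QuotientGroup.mk' D) ≤ H := by
    rintro _ ⟨x, hx, rfl⟩
    by_contra hxH
    have hopen : IsOpen ((K : Set G) ∩ (QuotientGroup.mk' D) ⁻¹' (H : Set (G ⧸ D))ᶜ) :=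
      hK.inter (hHclosed.isOpen_compl.preimage QuotientGroup.continuous_mk)
    obtain ⟨w, hw1, hw2⟩ := hf.exists_mem_open hopen ⟨x, hx, hxH⟩
    exact hw2 ⟨w, hw1, rfl⟩
  have hfinK : Finite (K.map (QuotientGroup.mk' D)) :=
    Finite.of_injective _ (Subgroup.inclusion_injective hKH)
  have hidx : (K.map (QuotientGroup.mk' D)).FiniteIndex := by
    refine ⟨fun h => ?_⟩
    have := Subgroup.index_map_dvd K (QuotientGroup.mk'_surjective D)
    rw [h, zero_dvd_iff] at this
    exact Subgroup.FiniteIndex.index_ne_zero this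
  have : Finite (G ⧸ D) := by
    refine Nat.finite_of_card_ne_zero ?_
    rw [← Subgroup.card_mul_index (K.map (QuotientGroup.mk' D))]
    exact mul_ne_zero Nat.card_pos.ne' hidx.index_ne_zero
  exact Subgroup.finiteIndex_of_finite_quotient

/-- The subgroups `D_i(F_n)` are open: by induction they have finite index, as `D_{i+2}` contains
the `p`-th powers and the commutators of `D_⌈(i+2)/p⌉ ∩ D_{i+1}`. -/
theorem FreeProP.isOpen_zassenhaus (n i : ℕ) :
    IsOpen (zassenhaus p (FreeProP p n) i : Set (FreeProP p n)) := by
  have key : ∀ i, (zassenhaus p (FreeProP p n) i).FiniteIndex := by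
    intro i
    induction i using Nat.strong_induction_on with
    | _ i ih =>
      match i, ih with
      | 0, _ => rw [zassenhaus]; infer_instance
      | 1, _ => rw [zassenhaus]; infer_instance
      | i + 2, ih =>
        have h1 := ih _ (ceilDiv_prime_lt p i)
        have h2 := ih (i + 1) (by omega)
        refine Subgroup.finiteIndex_of_pow_mem_of_commutator_mem p
          (K := zassenhaus p (FreeProP p n) ((i + 2) ⌈/⌉ p) ⊓
            zassenhaus p (FreeProP p n) (i + 1)) denseRange_ofWord ?_
          (isClosed_zassenhaus p _ _) ?_ ?_
        · exact Subgroup.isOpen_of_isClosed_of_finiteIndex _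
            ((isClosed_zassenhaus p _ _).inter (isClosed_zassenhaus p _ _))
        · intro x hx
          rw [zassenhaus]
          exact Subgroup.le_topologicalClosure _
            (Subgroup.mem_sup_left (Subgroup.subset_closure ⟨x, hx.1, rfl⟩))
        · intro x _ y hy
          rw [zassenhaus]
          refine Subgroup.le_topologicalClosure _ (Subgroup.mem_sup_right
            (Subgroup.mem_iSup_of_mem (0 : Fin (i + 1)) (Subgroup.commutator_mem_commutator ?_ ?_)))
          · simp [zassenhaus]
          · simpa using hy.2
  have := key i
  exact Subgroup.isOpen_of_isClosed_of_finiteIndex _ (isClosed_zassenhaus p _ _)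

theorem SigmaIso.quotient_zassenhaus {G H : Type*} [Group G] [TopologicalSpace G]
    [IsTopologicalGroup G] [CompactSpace G] [SigmaGroup G] [Group H] [TopologicalSpace H]
    [IsTopologicalGroup H] [T2Space H] [SigmaGroup H] (h : SigmaIso G H) (i : ℕ) :
    SigmaIso (G ⧸ zassenhaus p G i) (H ⧸ zassenhaus p H i) := by
  obtain ⟨e, he⟩ := h
  have hec : Continuous e.toMulEquiv.toMonoidHom := e.continuous
  refine sigmaIso_of_ker_eq (f := QuotientGroup.mk' (zassenhaus p G i))
    (g := (QuotientGroup.mk' (zassenhaus p H i)).comp e.toMulEquiv.toMonoidHom)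
    QuotientGroup.continuous_mk (QuotientGroup.continuous_mk.comp hec)
    (QuotientGroup.mk'_surjective _) ((QuotientGroup.mk'_surjective _).comp e.surjective)
    (fun _ => rfl) (fun x => congrArg (QuotientGroup.mk' _) (he x)) ?_
  rw [← MonoidHom.comap_ker, QuotientGroup.ker_mk', QuotientGroup.ker_mk',
    ← map_zassenhaus p hec e.surjective,
    Subgroup.comap_map_eq_self_of_injective (f := e.toMulEquiv.toMonoidHom) e.injective]

end Zassenhaus

/-! ### Continuity of `Θ_n` -/

section Theta

variable {p n : ℕ}

theorem isClosed_relSubgroup (r : Fin n → oddPart (FreeProP p n)) :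
    IsClosed (relSubgroup r : Set (FreeProP p n)) := Subgroup.isClosed_topologicalClosure _

instance (r : Fin n → oddPart (FreeProP p n)) : T2Space (SchurGroup r) :=
  have : IsClosed (relSubgroup r : Set (FreeProP p n)) := isClosed_relSubgroup r
  inferInstance

theorem mem_relSubgroup (r : Fin n → oddPart (FreeProP p n)) (i : Fin n) :
    (r i : FreeProP p n) ∈ relSubgroup r :=
  Subgroup.le_topologicalClosure _ (Subgroup.subset_normalClosure ⟨i, rfl⟩)

theorem relSubgroup_le {r : Fin n → oddPart (FreeProP p n)} {N : Subgroup (FreeProP p n)}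
    [N.Normal] (hN : IsClosed (N : Set (FreeProP p n))) (h : ∀ i, (r i : FreeProP p n) ∈ N) :
    relSubgroup r ≤ N :=
  Subgroup.topologicalClosure_minimal _
    (Subgroup.normalClosure_le_normal (Set.range_subset_iff.2 h)) hN

theorem Theta_eq_iff {a b : SchurData p} :
    Theta p a.1 a.2 = Theta p b.1 b.2 ↔ SigmaIso (SchurGroup a.2) (SchurGroup b.2) :=
  Quotient.eq (r := schurSetoid p)

variable [hp : Fact p.Prime]

/-- The map `F_n → G_r / D_i(G_r)`. -/
def toSchurQuotient (r : Fin n → oddPart (FreeProP p n)) (i : ℕ) :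
    FreeProP p n →* SchurGroup r ⧸ zassenhaus p (SchurGroup r) i :=
  (QuotientGroup.mk' _).comp (QuotientGroup.mk' (relSubgroup r))

theorem continuous_toSchurQuotient (r : Fin n → oddPart (FreeProP p n)) (i : ℕ) :
    Continuous (toSchurQuotient r i) := by
  have h1 : Continuous (QuotientGroup.mk' (relSubgroup r)) := QuotientGroup.continuous_mk
  have h2 : Continuous (QuotientGroup.mk' (zassenhaus p (SchurGroup r) i)) :=
    QuotientGroup.continuous_mk
  exact h2.comp h1

theorem toSchurQuotient_surjective (r : Fin n → oddPart (FreeProP p n)) (i : ℕ) :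
    Function.Surjective (toSchurQuotient r i) :=
  (QuotientGroup.mk'_surjective _).comp (QuotientGroup.mk'_surjective _)

theorem zassenhaus_le_ker_toSchurQuotient (r : Fin n → oddPart (FreeProP p n)) (i : ℕ) :
    zassenhaus p (FreeProP p n) i ≤ (toSchurQuotient r i).ker := by
  intro g hg
  refine (QuotientGroup.eq_one_iff _).2 ?_
  exact zassenhaus_le_comap p (QuotientGroup.mk' (relSubgroup r)) QuotientGroup.continuous_mk i hg

theorem ker_toSchurQuotient_le {r s : Fin n → oddPart (FreeProP p n)} {i : ℕ}
    (h : ∀ j, (s j : FreeProP p n)⁻¹ * r j ∈ zassenhaus p (FreeProP p n) i) :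
    (toSchurQuotient r i).ker ≤ (toSchurQuotient s i).ker := by
  have hrs : relSubgroup r ≤ (toSchurQuotient s i).ker := by
    refine relSubgroup_le (isClosed_singleton.preimage (continuous_toSchurQuotient s i))
      fun j => ?_
    have h1 : (s j : FreeProP p n) ∈ (toSchurQuotient s i).ker := by
      have : QuotientGroup.mk' (relSubgroup s) (s j) = 1 :=
        (QuotientGroup.eq_one_iff _).2 (mem_relSubgroup s j)
      rw [MonoidHom.mem_ker, toSchurQuotient, MonoidHom.comp_apply, this, map_one]
    have := mul_mem h1 (zassenhaus_le_ker_toSchurQuotient s i (h j))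
    rwa [mul_inv_cancel_left] at this
  intro g hg
  have hg' : QuotientGroup.mk' (relSubgroup r) g ∈ zassenhaus p (SchurGroup r) i :=
    (QuotientGroup.eq_one_iff _).1 hg
  rw [← map_zassenhaus p (f := QuotientGroup.mk' (relSubgroup r)) QuotientGroup.continuous_mk
    (QuotientGroup.mk'_surjective _)] at hg'
  obtain ⟨d, hd, hdg⟩ := hg'
  have h1 : d⁻¹ * g ∈ relSubgroup r := QuotientGroup.eq.1 hdg
  have := mul_mem (zassenhaus_le_ker_toSchurQuotient s i hd) (hrs h1)
  rwa [mul_inv_cancel_left] at this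

/-- The quotient `G_r / D_i(G_r)` depends only on `r` modulo `D_i(F_n)`. -/
theorem sigmaIso_quotient_zassenhaus_of_mem {r s : Fin n → oddPart (FreeProP p n)} {i : ℕ}
    (h : ∀ j, (s j : FreeProP p n)⁻¹ * r j ∈ zassenhaus p (FreeProP p n) i) :
    SigmaIso (SchurGroup r ⧸ zassenhaus p (SchurGroup r) i)
      (SchurGroup s ⧸ zassenhaus p (SchurGroup s) i) := by
  refine sigmaIso_of_ker_eq (continuous_toSchurQuotient r i) (continuous_toSchurQuotient s i)
    (toSchurQuotient_surjective r i) (toSchurQuotient_surjective s i) (fun _ => rfl)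
    (fun _ => rfl) (le_antisymm (ker_toSchurQuotient_le h) (ker_toSchurQuotient_le fun j => ?_))
  have := inv_mem (h j)
  rwa [mul_inv_rev, inv_inv] at this

theorem Theta_mem_basicOpen {i : ℕ} {a b : SchurData p} :
    Theta p b.1 b.2 ∈ basicOpen p i a ↔
      SigmaIso (SchurGroup b.2 ⧸ zassenhaus p (SchurGroup b.2) i)
        (SchurGroup a.2 ⧸ zassenhaus p (SchurGroup a.2) i) := by
  refine ⟨fun ⟨c, hc, h⟩ => ?_, fun h => ⟨b, rfl, h⟩⟩
  exact ((Theta_eq_iff.1 hc).symm.quotient_zassenhaus p i).trans h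

theorem continuous_Theta (p n : ℕ) [Fact p.Prime] : Continuous (Theta p n) := by
  refine continuous_generateFrom_iff.2 ?_
  rintro _ ⟨i, -, a, rfl⟩
  refine isOpen_iff_mem_nhds.2 fun r hr => ?_
  have hr' := (Theta_mem_basicOpen (b := ⟨n, r⟩)).1 hr
  have hev : ∀ᶠ s : Fin n → oddPart (FreeProP p n) in 𝓝 r, ∀ j,
      (r j : FreeProP p n)⁻¹ * s j ∈ zassenhaus p (FreeProP p n) i := by
    refine eventually_all.2 fun j => ?_
    have hc : Continuous fun s : Fin n → oddPart (FreeProP p n) =>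
        (r j : FreeProP p n)⁻¹ * s j :=
      continuous_const.mul (continuous_subtype_val.comp (continuous_apply j))
    refine hc.continuousAt.eventually_mem
      ((FreeProP.isOpen_zassenhaus p n i).mem_nhds ?_)
    rw [inv_mul_cancel]
    exact one_mem _
  filter_upwards [hev] with s hs
  exact (Theta_mem_basicOpen (b := ⟨n, s⟩)).2
    ((sigmaIso_quotient_zassenhaus_of_mem hs).trans hr')

end Theta

/-! ### The generator rank -/

section GeneratorRank

variable {p : ℕ} [hp : Fact p.Prime]

/-- A quotient map whose kernel is killed by all characters of order `p` preserves the
generator rank. -/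
theorem generatorRank_eq_of_isQuotientMap {G H : Type*} [Group G] [TopologicalSpace G] [Group H]
    [TopologicalSpace H] {q : G →* H} (hq : IsQuotientMap q)
    (hker : ∀ f ∈ H1 p G, ∀ x, q x = 1 → f x = 0) : generatorRank p H = generatorRank p G := by
  let Φ : H1 p H →ₗ[ZMod p] H1 p G :=
    { toFun := fun f => ⟨fun x => f.1 (q x), f.2.1.comp hq.continuous, fun g h => by
        simp only [map_mul, f.2.2]⟩
      map_add' := fun _ _ => rfl
      map_smul' := fun _ _ => rfl }
  refine LinearEquiv.finrank_eq (LinearEquiv.ofBijective Φ ⟨fun f g h => ?_, fun f => ?_⟩)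
  · refine Subtype.ext (funext fun y => ?_)
    obtain ⟨x, rfl⟩ := hq.surjective y
    exact congrFun (congrArg Subtype.val h) x
  · choose s hs using hq.surjective
    have hf1 : f.1 1 = 0 := by
      have := f.2.2 1 1
      rwa [mul_one, eq_comm, add_eq_left] at this
    have hsq : ∀ x, f.1 (s (q x)) = f.1 x := by
      intro x
      have h1 := hker f.1 f.2 ((s (q x))⁻¹ * x) (by rw [map_mul, map_inv, hs, inv_mul_cancel])
      have h2 := f.2.2 (s (q x)) ((s (q x))⁻¹ * x)
      rw [mul_inv_cancel_left, h1, add_zero] at h2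
      exact h2.symm
    refine ⟨⟨fun y => f.1 (s y), hq.continuous_iff.2 (f.2.1.congr fun x => (hsq x).symm),
      fun y z => ?_⟩, Subtype.ext (funext hsq)⟩
    obtain ⟨x, rfl⟩ := hq.surjective y
    obtain ⟨w, rfl⟩ := hq.surjective z
    rw [← map_mul]
    simp only [hsq, f.2.2]

theorem SigmaIso.generatorRank_eq {G H : Type*} [Group G] [TopologicalSpace G] [SigmaGroup G]
    [Group H] [TopologicalSpace H] [SigmaGroup H] (h : SigmaIso G H) :
    generatorRank p G = generatorRank p H := by
  obtain ⟨e, -⟩ := h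
  refine (generatorRank_eq_of_isQuotientMap (q := e.toMulEquiv.toMonoidHom)
    e.toHomeomorph.isQuotientMap fun f hf x hx => ?_).symm
  have hx1 : x = 1 := e.toMulEquiv.map_eq_one_iff.1 hx
  have := hf.2 1 1
  rw [hx1]
  rwa [mul_one, eq_comm, add_eq_left] at this

/-- An element of `H¹(G, 𝔽_p)` as a homomorphism to a multiplicative group. -/
def H1.toHom {G : Type*} [Group G] [TopologicalSpace G] (f : H1 p G) :
    G →* Multiplicative (ZMod p) :=
  MonoidHom.mk' (fun x => Multiplicative.ofAdd (f.1 x)) fun a b => by rw [f.2.2, ofAdd_add]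

theorem H1.continuous_toHom {G : Type*} [Group G] [TopologicalSpace G] (f : H1 p G) :
    Continuous (H1.toHom f) := by
  have : Continuous (Multiplicative.ofAdd : ZMod p → _) := continuous_of_discreteTopology
  exact this.comp f.2.1

theorem zassenhaus_two_zmod : zassenhaus p (Multiplicative (ZMod p)) 2 = ⊥ := by
  rw [eq_bot_iff]
  have hceil : (2 : ℕ) ⌈/⌉ p = 1 := by
    have := hp.out.two_le
    rw [Nat.ceilDiv_eq_add_pred_div, Nat.div_eq_iff hp.out.pos]
    omega
  rw [zassenhaus]
  refine Subgroup.topologicalClosure_minimal _ (sup_le ?_ (iSup_le fun i => ?_))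
    (isClosed_discrete _)
  · rw [Subgroup.closure_le]
    rintro _ ⟨x, -, rfl⟩
    refine Multiplicative.toAdd.injective ?_
    simp
  · rw [Subgroup.commutator_le]
    intro a _ b _
    rw [Subgroup.mem_bot, commutatorElement_eq_one_iff_mul_comm, mul_comm]

/-- The generator rank of `G` depends only on `G / D_2(G)`. This makes the sets `Sch_m` open. -/
theorem generatorRank_quotient_zassenhaus (G : Type*) [Group G] [TopologicalSpace G]
    [IsTopologicalGroup G] : generatorRank p (G ⧸ zassenhaus p G 2) = generatorRank p G := by
  refine generatorRank_eq_of_isQuotientMap (q := QuotientGroup.mk' (zassenhaus p G 2))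
    isQuotientMap_quot_mk fun f hf x hx => ?_
  have h1 : x ∈ zassenhaus p G 2 := (QuotientGroup.eq_one_iff x).1 hx
  have h2 := zassenhaus_le_comap p (H1.toHom ⟨f, hf⟩) (H1.continuous_toHom _) 2 h1
  rw [zassenhaus_two_zmod] at h2
  exact congrArg Multiplicative.toAdd (Subgroup.mem_bot.1 h2)

variable {n : ℕ}

/-- The matrix of exponent vectors of a tuple of odd elements. -/
def expMatrix (r : Fin n → oddPart (FreeProP p n)) : Matrix (Fin n) (Fin n) (ZMod p) :=
  Matrix.of fun i => FreeProP.expVec (r i : FreeProP p n)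

/-- The number of generators of `G_r` is the corank of the matrix of exponents of `r`: the
characters of `G_r` are the linear forms in the exponents that vanish on `r`. -/
theorem generatorRank_schurGroup (r : Fin n → oddPart (FreeProP p n)) :
    generatorRank p (SchurGroup r) + (expMatrix r).rank = n := by
  let Φ : H1 p (SchurGroup r) →ₗ[ZMod p] (Fin n → ZMod p) :=
    { toFun := fun f k => f.1 (FreeProP.gen p k : FreeProP p n)
      map_add' := fun _ _ => rfl
      map_smul' := fun _ _ => rfl }
  have hmk : Continuous (QuotientGroup.mk' (relSubgroup r)) := QuotientGroup.continuous_mk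
  have hsum : ∀ (f : H1 p (SchurGroup r)) (a : FreeProP p n), f.1 (a : SchurGroup r) =
      ∑ k, Φ f k * FreeProP.expVec a k := fun f a =>
    FreeProP.hom_zmod_eq_sum (f := fun a : FreeProP p n => f.1 (a : SchurGroup r))
      (f.2.1.comp hmk) (fun g h => by rw [QuotientGroup.mk_mul, f.2.2]) a
  have hinj : Function.Injective Φ := by
    intro f g hfg
    refine Subtype.ext (funext fun x => ?_)
    obtain ⟨a, rfl⟩ := QuotientGroup.mk_surjective x
    rw [hsum, hsum, hfg]
  have hrange : LinearMap.range Φ = LinearMap.ker (expMatrix r).mulVecLin := by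
    ext c
    rw [LinearMap.mem_ker, Matrix.mulVecLin_apply]
    constructor
    · rintro ⟨f, rfl⟩
      funext i
      have h1 := hsum f (r i)
      rw [(QuotientGroup.eq_one_iff _).2 (mem_relSubgroup r i)] at h1
      have h0 := f.2.2 1 1
      rw [mul_one, eq_comm, add_eq_left] at h0
      rw [h0] at h1
      simp only [Matrix.mulVec, dotProduct, expMatrix, Matrix.of_apply, Pi.zero_apply]
      rw [h1]
      exact Finset.sum_congr rfl fun k _ => mul_comm _ _
    · intro hc
      let f : H1 p (FreeProP p n) := ⟨fun a => ∑ k, c k * FreeProP.expVec a k,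
        continuous_finsetSum _ fun i _ => continuous_const.mul
          ((continuous_apply i).comp FreeProP.continuous_expVec),
        fun a b => by rw [← Finset.sum_add_distrib]; simp [mul_add]⟩
      have hle : relSubgroup r ≤ (H1.toHom f).ker := by
        refine relSubgroup_le (isClosed_singleton.preimage (H1.continuous_toHom f)) fun i => ?_
        have hi := congrFun hc i
        simp only [Matrix.mulVec, dotProduct, expMatrix, Matrix.of_apply, Pi.zero_apply] at hi
        refine Multiplicative.toAdd.injective ?_
        change ∑ k, c k * FreeProP.expVec (r i : FreeProP p n) k = 0
        rw [← hi]
        exact Finset.sum_congr rfl fun k _ => mul_comm _ _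
      let F : SchurGroup r →* Multiplicative (ZMod p) :=
        QuotientGroup.lift (relSubgroup r) (H1.toHom f) hle
      have hto : Continuous (Multiplicative.toAdd : Multiplicative (ZMod p) → _) :=
        continuous_of_discreteTopology
      have hF : Continuous F :=
        continuous_quot_lift _ (H1.continuous_toHom f)
      refine ⟨⟨fun x => (F x).toAdd, hto.comp hF, fun a b => by simp only [map_mul, toAdd_mul]⟩, ?_⟩
      funext k
      change ∑ j, c j * FreeProP.expVec (FreeProP.gen p k) j = c k
      simp [FreeProP.expVec_gen, Pi.single_apply]
  have h1 : generatorRank p (SchurGroup r) =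
      Module.finrank (ZMod p) (LinearMap.ker (expMatrix r).mulVecLin) := by
    rw [← hrange]
    exact (LinearMap.finrank_range_of_inj hinj).symm
  have h2 := LinearMap.finrank_range_add_finrank_ker (expMatrix r).mulVecLin
  rw [h1, Matrix.rank, add_comm, h2]
  simp

theorem Theta_mem_SchEq {m : ℕ} (r : Fin n → oddPart (FreeProP p n)) :
    Theta p n r ∈ SchEq p m ↔ generatorRank p (SchurGroup r) = m := by
  refine ⟨fun ⟨a, ha, h⟩ => ?_, fun h => ⟨⟨n, r⟩, rfl, h⟩⟩
  have := Theta_eq_iff (b := ⟨n, r⟩).1 ha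
  rw [← h]
  exact this.symm.generatorRank_eq

theorem isOpen_SchEq (m : ℕ) : IsOpen (SchEq p m) := by
  have : SchEq p m = ⋃ (a : SchurData p) (_ : generatorRank p (SchurGroup a.2) = m),
      basicOpen p 2 a := by
    ext x
    simp only [Set.mem_iUnion]
    constructor
    · rintro ⟨a, rfl, ha⟩
      exact ⟨a, ha, a, rfl, ContinuousMulEquiv.refl _, fun _ => rfl⟩
    · rintro ⟨a, ha, b, rfl, h⟩
      refine ⟨b, rfl, ?_⟩
      rw [← ha, ← generatorRank_quotient_zassenhaus (SchurGroup a.2),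
        ← generatorRank_quotient_zassenhaus (SchurGroup b.2)]
      exact h.generatorRank_eq
  rw [this]
  exact isOpen_biUnion fun a _ => TopologicalSpace.isOpen_generateFrom_of_mem ⟨2, le_rfl, a, rfl⟩

variable (p)

theorem pairwise_disjoint_SchEq : Pairwise (Function.onFun Disjoint (SchEq p)) := by
  intro k m hkm
  refine Set.disjoint_left.2 ?_
  rintro _ ⟨a, rfl, ha⟩ hm
  exact hkm (ha.symm.trans ((Theta_mem_SchEq a.2).1 hm))

theorem iUnion_SchEq : ⋃ m, SchEq p m = Set.univ := by
  refine Set.eq_univ_of_forall fun x => ?_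
  obtain ⟨a, rfl⟩ := Quotient.exists_rep x
  exact Set.mem_iUnion.2 ⟨_, a, rfl, rfl⟩

end GeneratorRank

/-! ### Counting tuples of given rank over a finite field -/

section Counting

open Module

theorem finrank_span_range_cons {K V : Type*} [Field K] [AddCommGroup V] [Module K V]
    [FiniteDimensional K V] {k : ℕ} (x : V) (v : Fin k → V) [Decidable
      (x ∈ Submodule.span K (Set.range v))] :
    finrank K (Submodule.span K (Set.range (Fin.cons x v : Fin (k + 1) → V))) =
      finrank K (Submodule.span K (Set.range v)) +
        if x ∈ Submodule.span K (Set.range v) then 0 else 1 := by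
  rw [Fin.range_cons, Submodule.span_insert]
  split_ifs with h
  · rw [sup_eq_right.2 ((Submodule.span_singleton_le_iff_mem _ _).2 h), add_zero]
  · have h1 := Submodule.finrank_sup_add_finrank_inf_eq (Submodule.span K {x})
      (Submodule.span K (Set.range v))
    have h0 : x ≠ 0 := by
      rintro rfl
      exact h (zero_mem _)
    have h2 : Submodule.span K {x} ⊓ Submodule.span K (Set.range v) = ⊥ :=
      disjoint_iff.1 ((Submodule.disjoint_span_singleton' h0).2 h).symm
    rw [h2, finrank_bot, finrank_span_singleton h0] at h1
    omega

/-- The number of `k`-tuples in `V` that span a subspace of dimension `s`. -/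
def rankCount (K V : Type*) [Field K] [AddCommGroup V] [Module K V] (k s : ℕ) : ℕ :=
  Nat.card {v : Fin k → V // finrank K (Submodule.span K (Set.range v)) = s}

variable (K V : Type*) [Field K] [Finite K] [AddCommGroup V] [Module K V]
  [FiniteDimensional K V]

theorem natCard_notMem (W : Submodule K V) :
    (Nat.card {x // x ∉ W} : ℝ) = (Nat.card K : ℝ) ^ finrank K V - Nat.card W := by
  classical
  have : Finite V := Module.finite_of_finite K
  have hfin : Fintype V := Fintype.ofFinite V
  rw [← Nat.cast_pow, ← Module.natCard_eq_pow_finrank (K := K) (V := V), eq_sub_iff_add_eq,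
    ← Nat.cast_add]
  congr 1
  rw [Nat.card_eq_fintype_card, Nat.card_eq_fintype_card, Nat.card_eq_fintype_card,
    Fintype.card_subtype_compl]
  exact Nat.sub_add_cancel (Fintype.card_subtype_le _)

theorem rankCount_succ_eq (k t : ℕ) [Fintype (Fin k → V)] : rankCount K V (k + 1) t =
    ∑ v : Fin k → V, Nat.card {x : V // finrank K
      (Submodule.span K (Set.range (Fin.cons x v : Fin (k + 1) → V))) = t} := by
  have : Finite V := Module.finite_of_finite K
  have hfin : Fintype V := Fintype.ofFinite V
  rw [rankCount, ← Nat.card_sigma]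
  refine Nat.card_congr ?_
  refine Equiv.trans (Equiv.subtypeEquivOfSubtype' (Fin.consEquiv fun _ : Fin (k + 1) => V).symm)
    ?_
  exact
    { toFun := fun y => ⟨y.1.2, y.1.1, y.2⟩
      invFun := fun y => ⟨(y.2.1, y.1), y.2.2⟩
      left_inv := fun _ => rfl
      right_inv := fun _ => rfl }

theorem rankCount_succ_zero (k : ℕ) : rankCount K V (k + 1) 0 = rankCount K V k 0 := by
  classical
  have : Finite V := Module.finite_of_finite K
  have hfin : Fintype V := Fintype.ofFinite V
  rw [rankCount_succ_eq]
  have h : ∀ v : Fin k → V, Nat.card {x : V // finrank K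
      (Submodule.span K (Set.range (Fin.cons x v : Fin (k + 1) → V))) = 0} =
      if finrank K (Submodule.span K (Set.range v)) = 0 then 1 else 0 := by
    intro v
    simp only [finrank_span_range_cons]
    split_ifs with hv
    · have : Submodule.span K (Set.range v) = ⊥ := Submodule.finrank_eq_zero.1 hv
      rw [this]
      simp
    · simp [hv]
  rw [Finset.sum_congr rfl fun v _ => h v, Finset.sum_boole, rankCount,
    Nat.card_eq_fintype_card, Fintype.card_subtype, Nat.cast_id]

/-- A tuple of rank `s + 1` arises by adding a vector of the span to a tuple of rank `s + 1`, or
a vector outside the span to a tuple of rank `s`. -/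
theorem rankCount_succ_succ (k s : ℕ) : (rankCount K V (k + 1) (s + 1) : ℝ) =
    (Nat.card K : ℝ) ^ (s + 1) * rankCount K V k (s + 1) +
      ((Nat.card K : ℝ) ^ finrank K V - (Nat.card K : ℝ) ^ s) * rankCount K V k s := by
  classical
  have : Finite V := Module.finite_of_finite K
  have hfin : Fintype V := Fintype.ofFinite V
  have h : ∀ v : Fin k → V, (Nat.card {x : V // finrank K
      (Submodule.span K (Set.range (Fin.cons x v : Fin (k + 1) → V))) = s + 1} : ℝ) =
      (Nat.card K : ℝ) ^ (s + 1) *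
        (if finrank K (Submodule.span K (Set.range v)) = s + 1 then 1 else 0) +
      ((Nat.card K : ℝ) ^ finrank K V - (Nat.card K : ℝ) ^ s) *
        (if finrank K (Submodule.span K (Set.range v)) = s then 1 else 0) := by
    intro v
    have hW : (Nat.card (Submodule.span K (Set.range v)) : ℝ) =
        (Nat.card K : ℝ) ^ finrank K (Submodule.span K (Set.range v)) := by
      rw [Module.natCard_eq_pow_finrank (K := K), Nat.cast_pow]
    by_cases h1 : finrank K (Submodule.span K (Set.range v)) = s + 1
    · have e : {x : V // finrank K
          (Submodule.span K (Set.range (Fin.cons x v : Fin (k + 1) → V))) = s + 1} ≃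
          Submodule.span K (Set.range v) := Equiv.subtypeEquivRight fun x => by
        rw [finrank_span_range_cons, h1]
        split_ifs with hx <;> simp [hx]
      rw [Nat.card_congr e, hW, h1]
      simp
    · by_cases h2 : finrank K (Submodule.span K (Set.range v)) = s
      · have e : {x : V // finrank K
            (Submodule.span K (Set.range (Fin.cons x v : Fin (k + 1) → V))) = s + 1} ≃
            {x // x ∉ Submodule.span K (Set.range v)} := Equiv.subtypeEquivRight fun x => by
          rw [finrank_span_range_cons, h2]
          split_ifs with hx <;> simp [hx]
        rw [Nat.card_congr e, natCard_notMem, hW, h2]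
        simp
      · have e : IsEmpty {x : V // finrank K
            (Submodule.span K (Set.range (Fin.cons x v : Fin (k + 1) → V))) = s + 1} := by
          refine ⟨fun x => ?_⟩
          have hx := x.2
          rw [finrank_span_range_cons] at hx
          split_ifs at hx <;> omega
        rw [Nat.card_of_isEmpty]
        simp [h1, h2]
  have hcount : ∀ t, (rankCount K V k t : ℝ) =
      ∑ v : Fin k → V, if finrank K (Submodule.span K (Set.range v)) = t then (1 : ℝ) else 0 := by
    intro t
    rw [Finset.sum_boole, rankCount, Nat.card_eq_fintype_card, Fintype.card_subtype]
  rw [rankCount_succ_eq, Nat.cast_sum, Finset.sum_congr rfl fun v _ => h v,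
    Finset.sum_add_distrib, ← Finset.mul_sum, ← Finset.mul_sum, ← hcount, ← hcount]

theorem prod_pow_succ_sub (q : ℝ) (k s : ℕ) :
    ∏ i ∈ Finset.range (s + 1), (q ^ (k + 1) - q ^ i) =
      (q ^ (k + 1) - 1) * q ^ s * ∏ i ∈ Finset.range s, (q ^ k - q ^ i) := by
  rw [Finset.prod_range_succ']
  have : ∀ i ∈ Finset.range s, q ^ (k + 1) - q ^ (i + 1) = q * (q ^ k - q ^ i) := fun i _ => by
    ring
  rw [Finset.prod_congr rfl this, Finset.prod_mul_distrib, Finset.prod_const, Finset.card_range,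
    pow_zero]
  ring

/-- The number of `k`-tuples of rank `s` in a space of dimension `n` over `𝔽_q` is
`∏ (qⁿ - qⁱ) (qᵏ - qⁱ) / (qˢ - qⁱ)`, the product being over `i < s`. -/
theorem rankCount_mul_prod (k s : ℕ) :
    (rankCount K V k s : ℝ) *
        ∏ i ∈ Finset.range s, ((Nat.card K : ℝ) ^ s - (Nat.card K : ℝ) ^ i) =
      (∏ i ∈ Finset.range s, ((Nat.card K : ℝ) ^ finrank K V - (Nat.card K : ℝ) ^ i)) *
        ∏ i ∈ Finset.range s, ((Nat.card K : ℝ) ^ k - (Nat.card K : ℝ) ^ i) := by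
  induction k generalizing s with
  | zero =>
    have hfr : ∀ v : Fin 0 → V, finrank K (Submodule.span K (Set.range v)) = 0 := by
      intro v
      rw [Set.range_eq_empty, Submodule.span_empty, finrank_bot]
    cases s with
    | zero => simp [rankCount, hfr]
    | succ s =>
      have : (rankCount K V 0 (s + 1) : ℝ) = 0 := by
        have he : IsEmpty {v : Fin 0 → V //
            finrank K (Submodule.span K (Set.range v)) = s + 1} :=
          ⟨fun v => by have := v.2; rw [hfr] at this; omega⟩
        rw [rankCount, Nat.card_of_isEmpty, Nat.cast_zero]
      rw [this, zero_mul, eq_comm, mul_eq_zero]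
      right
      exact Finset.prod_eq_zero (Finset.mem_range.2 (Nat.succ_pos s)) (by simp)
  | succ k ih =>
    cases s with
    | zero =>
      have := ih 0
      simpa [rankCount_succ_zero] using this
    | succ s =>
      have h1 := ih (s + 1)
      have h2 := ih s
      set q : ℝ := (Nat.card K : ℝ)
      rw [rankCount_succ_succ, prod_pow_succ_sub q k s, add_mul, mul_assoc, h1,
        prod_pow_succ_sub q s s]
      rw [show (q ^ finrank K V - q ^ s) * (rankCount K V k s : ℝ) *
          ((q ^ (s + 1) - 1) * q ^ s * ∏ i ∈ Finset.range s, (q ^ s - q ^ i)) =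
          (q ^ finrank K V - q ^ s) * (q ^ (s + 1) - 1) * q ^ s *
          ((rankCount K V k s : ℝ) * ∏ i ∈ Finset.range s, (q ^ s - q ^ i)) by ring, h2,
        Finset.prod_range_succ, Finset.prod_range_succ]
      ring

end Counting

section Constants

variable {p : ℕ}

theorem constC_factor_pos (hp : 2 < p) (i : ℕ) : 0 < 1 - ((p : ℝ) ^ (i + 1))⁻¹ := by
  have h1 : (1 : ℝ) < p := by exact_mod_cast (by omega : 1 < p)
  exact sub_pos.2 (inv_lt_one_of_one_lt₀ (one_lt_pow₀ h1 (Nat.succ_ne_zero i)))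

theorem constC_pos (hp : 2 < p) (k : ℕ) : 0 < constC p k :=
  Finset.prod_pos fun i _ => constC_factor_pos hp i

theorem constC_antitone (hp : 2 < p) : Antitone (constC p) := by
  refine antitone_nat_of_succ_le fun k => ?_
  rw [constC, Finset.prod_range_succ]
  refine mul_le_of_le_one_right (constC_pos hp k).le (sub_le_self _ ?_)
  positivity

theorem tendsto_constC (hp : 2 < p) : Tendsto (constC p) atTop (𝓝 (constCInf p)) :=
  (multipliable_constCInf p hp).hasProd.tendsto_prod_nat

theorem constC_le_one (hp : 2 < p) (k : ℕ) : constC p k ≤ 1 := by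
  have := constC_antitone hp (Nat.zero_le k)
  simpa [constC] using this

theorem constCInf_le (hp : 2 < p) (k : ℕ) : constCInf p ≤ constC p k :=
  (constC_antitone hp).le_of_tendsto (tendsto_constC hp) k

/-- The infinite product `C_∞` does not vanish: as `p ≥ 3`, its partial products `C_k` are at
least `(1 + p⁻ᵏ) / 2`. -/
theorem constCInf_pos (hp : 2 < p) : 0 < constCInf p := by
  have h1 : (3 : ℝ) ≤ p := by exact_mod_cast hp
  have h0 : (0 : ℝ) < p := by linarith
  have key : ∀ k, 1 / 2 + 1 / 2 * ((p : ℝ) ^ k)⁻¹ ≤ constC p k := by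
    intro k
    induction k with
    | zero => norm_num [constC]
    | succ k ih =>
      have hx : ((p : ℝ) ^ (k + 1))⁻¹ * 3 ≤ ((p : ℝ) ^ k)⁻¹ := by
        rw [pow_succ, mul_inv, mul_assoc]
        refine mul_le_of_le_one_right (by positivity) ?_
        rw [inv_mul_le_iff₀ h0]
        linarith
      have hpos : 0 < ((p : ℝ) ^ (k + 1))⁻¹ := by positivity
      have hle := constC_le_one hp k
      have hsucc : constC p (k + 1) = constC p k * (1 - ((p : ℝ) ^ (k + 1))⁻¹) := by
        rw [constC, constC, Finset.prod_range_succ]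
      rw [hsucc]
      nlinarith
  have h := ge_of_tendsto' (tendsto_constC hp) fun k =>
    le_trans (le_add_of_nonneg_right (by positivity)) (key k)
  linarith

theorem prod_pow_sub_mul_constC (hp : 2 < p) (m r : ℕ) :
    (∏ i ∈ Finset.range r, ((p : ℝ) ^ (m + r) - (p : ℝ) ^ i)) * constC p m =
      (p : ℝ) ^ ((m + r) * r) * constC p (m + r) := by
  have h0 : (p : ℝ) ≠ 0 := by
    have : p ≠ 0 := by omega
    exact_mod_cast this
  induction r with
  | zero => simp
  | succ r ih =>
    have hsucc : constC p (m + (r + 1)) =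
        constC p (m + r) * (1 - ((p : ℝ) ^ (m + r + 1))⁻¹) := by
      rw [constC, constC, ← add_assoc, Finset.prod_range_succ]
    rw [hsucc, ← add_assoc, prod_pow_succ_sub, mul_assoc, ih]
    have hx : (p : ℝ) ^ (m + r + 1) * ((p : ℝ) ^ (m + r + 1))⁻¹ = 1 :=
      mul_inv_cancel₀ (pow_ne_zero _ h0)
    rw [show (m + r + 1) * (r + 1) = (m + r) * r + r + (m + r + 1) by ring,
      pow_add _ ((m + r) * r + r), pow_add _ ((m + r) * r)]
    linear_combination ((p : ℝ) ^ ((m + r) * r) * (p : ℝ) ^ r * constC p (m + r)) * hx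

/-- The number of `n × n`-matrices of corank `m` over `𝔽_p`. -/
theorem rankCount_corank (hp : 2 < p) [Fact p.Prime] (m r : ℕ) :
    (rankCount (ZMod p) (Fin (m + r) → ZMod p) (m + r) r : ℝ) * (p : ℝ) ^ (m ^ 2) =
      (p : ℝ) ^ ((m + r) ^ 2) * (constC p (m + r) ^ 2 / (constC p m ^ 2 * constC p r)) := by
  have h0 : (p : ℝ) ≠ 0 := by
    have : p ≠ 0 := by omega
    exact_mod_cast this
  have h1 := rankCount_mul_prod (ZMod p) (Fin (m + r) → ZMod p) (m + r) r
  have h2 := prod_pow_sub_mul_constC hp m r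
  have h3 := prod_pow_sub_mul_constC hp 0 r
  have hc0 : constC p 0 = 1 := by simp [constC]
  rw [hc0, mul_one, zero_add] at h3
  rw [Nat.card_zmod, Module.finrank_fin_fun, h3] at h1
  have hm := (constC_pos hp m).ne'
  have hr := (constC_pos hp r).ne'
  rw [← mul_div_assoc, eq_div_iff (mul_ne_zero (pow_ne_zero _ hm) hr)]
  refine mul_right_cancel₀ (pow_ne_zero (r * r) h0) ?_
  calc _ = ((rankCount (ZMod p) (Fin (m + r) → ZMod p) (m + r) r : ℝ) *
        ((p : ℝ) ^ (r * r) * constC p r)) * constC p m ^ 2 * (p : ℝ) ^ (m ^ 2) := by ring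
    _ = ((∏ i ∈ Finset.range r, ((p : ℝ) ^ (m + r) - (p : ℝ) ^ i)) * constC p m) ^ 2 *
        (p : ℝ) ^ (m ^ 2) := by rw [h1]; ring
    _ = _ := by
      rw [h2, show (m + r) ^ 2 = m ^ 2 + 2 * m * r + r * r by ring]
      ring

/-- The factor by which `μ_n` and `μ_m` differ on `Sch_m`; it vanishes for `n < m`. -/
def corankCoeff (p n m : ℕ) : ℝ :=
  if m ≤ n then constC p n ^ 2 / (constC p m ^ 2 * constC p (n - m)) else 0

theorem corankCoeff_nonneg (hp2 : 2 < p) (n m : ℕ) : 0 ≤ corankCoeff p n m := by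
  have h1 := constC_pos hp2 m
  have h2 := constC_pos hp2 (n - m)
  rw [corankCoeff]
  split_ifs <;> positivity

theorem corankCoeff_le (hp2 : 2 < p) (n m : ℕ) :
    corankCoeff p n m ≤ 1 / constCInf p ^ 3 := by
  have h0 := constCInf_pos hp2
  rw [corankCoeff]
  split_ifs
  · refine div_le_div₀ zero_le_one (pow_le_one₀ (constC_pos hp2 n).le (constC_le_one hp2 n))
      (by positivity) ?_
    rw [show constCInf p ^ 3 = constCInf p ^ 2 * constCInf p by ring]
    exact mul_le_mul (pow_le_pow_left₀ h0.le (constCInf_le hp2 m) 2) (constCInf_le hp2 _) h0.le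
      (by positivity)
  · positivity

theorem le_corankCoeff (hp2 : 2 < p) {n m : ℕ} (h : m ≤ n) :
    constCInf p ^ 2 ≤ corankCoeff p n m := by
  have h0 := constCInf_pos hp2
  have h1 := constC_pos hp2 m
  have h2 := constC_pos hp2 (n - m)
  rw [corankCoeff, if_pos h, le_div_iff₀ (by positivity)]
  calc constCInf p ^ 2 * (constC p m ^ 2 * constC p (n - m)) ≤ constCInf p ^ 2 * (1 * 1) := by
        refine mul_le_mul_of_nonneg_left ?_ (by positivity)
        exact mul_le_mul (pow_le_one₀ h1.le (constC_le_one hp2 m)) (constC_le_one hp2 _) h2.le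
          zero_le_one
    _ ≤ constC p n ^ 2 := by
        rw [mul_one, mul_one]
        exact pow_le_pow_left₀ h0.le (constCInf_le hp2 n) 2

theorem tendsto_corankCoeff (hp2 : 2 < p) (m : ℕ) :
    Tendsto (fun n => corankCoeff p n m) atTop (𝓝 (constCInf p / constC p m ^ 2)) := by
  have h0 := (constCInf_pos hp2).ne'
  have h1 := (constC_pos hp2 m).ne'
  have hsub : Tendsto (fun n => constC p (n - m)) atTop (𝓝 (constCInf p)) :=
    (tendsto_constC hp2).comp (tendsto_sub_atTop_nat m)
  have h := ((tendsto_constC hp2).pow 2).div (hsub.const_mul (constC p m ^ 2))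
    (mul_ne_zero (pow_ne_zero 2 h1) h0)
  have heq : constCInf p ^ 2 / (constC p m ^ 2 * constCInf p) =
      constCInf p / constC p m ^ 2 := by
    field_simp
  rw [heq] at h
  refine h.congr' ?_
  filter_upwards [eventually_ge_atTop m] with n hn
  rw [corankCoeff, if_pos hn]
  rfl

end Constants

/-! ### Eliminating the relations that are not in the Frattini subgroup -/

namespace FreeProP

variable {p n : ℕ} [hp : Fact p.Prime]

theorem exists_mem_closure_expVec_eq {S : Set (FreeProP p n)} {c : Fin n → ZMod p}
    (hc : c ∈ Submodule.span (ZMod p) (expVec '' S)) :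
    ∃ t ∈ Subgroup.closure S, expVec t = c := by
  induction hc using Submodule.span_induction with
  | mem x hx =>
    obtain ⟨t, ht, rfl⟩ := hx
    exact ⟨t, Subgroup.subset_closure ht, rfl⟩
  | zero => exact ⟨1, one_mem _, expVec_one⟩
  | add x y _ _ hx hy =>
    obtain ⟨s, hs, rfl⟩ := hx
    obtain ⟨t, ht, rfl⟩ := hy
    exact ⟨s * t, mul_mem hs ht, expVec_mul s t⟩
  | smul a x _ hx =>
    obtain ⟨t, ht, rfl⟩ := hx
    refine ⟨t ^ a.val, pow_mem ht _, ?_⟩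
    rw [expVec_pow, ← Nat.cast_smul_eq_nsmul (ZMod p), ZMod.natCast_zmod_val]

theorem expVec_surjective : Function.Surjective (expVec : FreeProP p n → Fin n → ZMod p) := by
  intro c
  have hc : c ∈ Submodule.span (ZMod p) (expVec '' Set.range fun i : Fin n => gen p i) := by
    have : (expVec '' Set.range fun i : Fin n => gen p i) =
        Set.range (Pi.basisFun (ZMod p) (Fin n)) := by
      rw [← Set.range_comp]
      congr 1
      funext i
      simp [expVec_gen]
    rw [this, (Pi.basisFun (ZMod p) (Fin n)).span_eq]
    trivial
  obtain ⟨t, -, ht⟩ := exists_mem_closure_expVec_eq hc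
  exact ⟨t, ht⟩

instance : Subsingleton (FreeProP p 0) := by
  refine ⟨fun a b => ?_⟩
  have h : MonoidHom.id (FreeProP p 0) = 1 :=
    hom_ext continuous_id continuous_const fun i => i.elim0
  exact (DFunLike.congr_fun h a).trans (DFunLike.congr_fun h b).symm

theorem exists_oddPart_expVec_eq (hp2 : 2 < p) (c : Fin n → ZMod p) :
    ∃ s : oddPart (FreeProP p n), expVec (s : FreeProP p n) = c := by
  obtain ⟨s, -, hs⟩ := exists_odd_expVec (m := 0) (ψ := (1 : FreeProP p n →* FreeProP p 0)) hp2
    (fun _ => Subsingleton.elim _ _) (W := ⊤)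
    (fun c _ => (expVec_surjective c).imp fun t ht => ⟨rfl, ht⟩) (c := c) trivial
  refine ⟨⟨(s : FreeProP p n) * s, ?_⟩, (expVec_mul _ _).trans hs⟩
  have hs' : sigma (s : FreeProP p n) = (s : FreeProP p n)⁻¹ := s.2
  change sigma ((s : FreeProP p n) * s) = _
  rw [map_mul, hs', mul_inv_rev]

/-- The exponent vectors of a random tuple in `F_n⁻` are uniformly distributed. -/
theorem measure_expVec_eq (hp2 : 2 < p) {ι : Type*} [Fintype ι] (c : ι → Fin n → ZMod p) :
    ((p : ℝ≥0∞) ^ n) ^ Fintype.card ι * Measure.pi (fun _ : ι => oddHaar p n)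
      {r | ∀ i, expVec (r i : FreeProP p n) = c i} = 1 := by
  have hprob := (isOddHaar_oddHaar p 0 hp2).1
  have h := measure_expVec_inter_preimage (m := 0) (ι := ι)
    (ψ := (1 : FreeProP p n →* FreeProP p 0)) hp2
    continuous_const (fun _ => ⟨1, Subsingleton.elim _ _⟩)
    (fun _ => Subsingleton.elim _ _) (W := ⊤)
    (fun c _ => (expVec_surjective c).imp fun t ht => ⟨rfl, ht⟩) (B := Set.univ)
    MeasurableSet.univ (fun _ _ _ => trivial) c (fun _ => trivial)
  rw [measure_univ] at h
  rw [← h]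
  congr 2
  · rw [Module.natCard_eq_pow_finrank (K := ZMod p), finrank_top, Module.finrank_fin_fun,
      Nat.card_zmod, Nat.cast_pow]
  · ext r
    simp

/-- The linear map `𝔽_p^n → 𝔽_p^m` induced by a homomorphism `F_n → F_m`. -/
def expMap {m : ℕ} (ψ : FreeProP p n →* FreeProP p m) :
    (Fin n → ZMod p) →ₗ[ZMod p] (Fin m → ZMod p) :=
  Fintype.linearCombination (ZMod p) fun i => expVec (ψ (gen p i))

theorem expMap_expVec {m : ℕ} {ψ : FreeProP p n →* FreeProP p m} (hψ : Continuous ψ)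
    (a : FreeProP p n) : expMap ψ (expVec a) = expVec (ψ a) := by
  funext k
  have := hom_zmod_eq_sum (f := fun a => expVec (ψ a) k)
    ((continuous_apply k).comp (continuous_expVec.comp hψ)) (fun g h => by simp) a
  rw [this, expMap, Fintype.linearCombination_apply]
  simp [mul_comm]

/-- If `ψ : F_n → F_m` is surjective and kills elements whose exponent vectors span a subspace
`W` of dimension `n - m`, then `W` consists of the exponent vectors of all elements mapped by
`ψ` to the Frattini subgroup. -/
theorem mem_of_expVec_map_eq_zero {m : ℕ} {ψ : FreeProP p n →* FreeProP p m}
    (hψ : Continuous ψ) (hsurj : Function.Surjective ψ)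
    {W : Submodule (ZMod p) (Fin n → ZMod p)} (hW : ∀ c ∈ W, ∃ t, ψ t = 1 ∧ expVec t = c)
    (hdim : Module.finrank (ZMod p) W + m = n) {a : FreeProP p n} (ha : expVec (ψ a) = 0) :
    expVec a ∈ W := by
  have hs : Function.Surjective (expMap ψ) := by
    intro c
    obtain ⟨b, rfl⟩ := expVec_surjective c
    obtain ⟨a, rfl⟩ := hsurj b
    exact ⟨expVec a, expMap_expVec hψ a⟩
  have hle : W ≤ LinearMap.ker (expMap ψ) := by
    intro c hc
    obtain ⟨t, ht, rfl⟩ := hW c hc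
    rw [LinearMap.mem_ker, expMap_expVec hψ, ht, expVec_one]
  have hdim' := LinearMap.finrank_range_add_finrank_ker (expMap ψ)
  rw [LinearMap.range_eq_top.2 hs, finrank_top, Module.finrank_fin_fun,
    Module.finrank_fin_fun] at hdim'
  have heq : W = LinearMap.ker (expMap ψ) :=
    Submodule.eq_of_le_of_finrank_eq hle (by omega)
  rw [heq, LinearMap.mem_ker, expMap_expVec hψ, ha]

end FreeProP

section Elimination

variable {p n : ℕ} [hp : Fact p.Prime]

/-- If the quotient of `F_n` by some of the relations `r_j` is `F_m`, then `G_r` is the quotient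
of `F_m` by the images of the remaining relations. -/
theorem sigmaIso_schurGroup_of_quotient_hom {m : ℕ} {P : Fin n → Prop}
    (e : {i // ¬ P i} ≃ Fin m) (r : Fin n → oddPart (FreeProP p n))
    {ψ : FreeProP p n →* FreeProP p m} (hψ : Continuous ψ) (hsurj : Function.Surjective ψ)
    (hσ : ∀ a, ψ (sigma a) = sigma (ψ a))
    (hker : ψ.ker = (Subgroup.normalClosure
      (Set.range fun j : {j // P j} => (r j : FreeProP p n))).topologicalClosure) :
    SigmaIso (SchurGroup r) (SchurGroup fun k => FreeProP.oddMap ψ hσ (r (e.symm k))) := by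
  set s : Fin m → oddPart (FreeProP p m) := fun k => FreeProP.oddMap ψ hσ (r (e.symm k)) with hs
  have hmkr : Continuous (QuotientGroup.mk' (relSubgroup r)) := QuotientGroup.continuous_mk
  have hmks : Continuous (QuotientGroup.mk' (relSubgroup s)) := QuotientGroup.continuous_mk
  refine sigmaIso_of_ker_eq (f := QuotientGroup.mk' (relSubgroup r))
    (g := (QuotientGroup.mk' (relSubgroup s)).comp ψ) hmkr (hmks.comp hψ)
    (QuotientGroup.mk'_surjective _) ((QuotientGroup.mk'_surjective _).comp hsurj)
    (fun _ => rfl) (fun x => congrArg (QuotientGroup.mk' _) (hσ x)) ?_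
  rw [QuotientGroup.ker_mk']
  refine le_antisymm (relSubgroup_le (isClosed_singleton.preimage (hmks.comp hψ)) fun i => ?_) ?_
  · refine (QuotientGroup.eq_one_iff _).2 ?_
    by_cases h : P i
    · have : (r i : FreeProP p n) ∈ ψ.ker := by
        rw [hker]
        exact Subgroup.le_topologicalClosure _ (Subgroup.subset_normalClosure ⟨⟨i, h⟩, rfl⟩)
      rw [MonoidHom.mem_ker.1 this]
      exact one_mem _
    · have hse : (s (e ⟨i, h⟩) : FreeProP p m) = ψ (r i) := by simp [hs, FreeProP.oddMap]
      rw [← hse]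
      exact mem_relSubgroup s (e ⟨i, h⟩)
  · intro a ha
    have ha' : ψ a ∈ relSubgroup s := (QuotientGroup.eq_one_iff _).1 ha
    have hnorm : ((relSubgroup r).map ψ).Normal := Subgroup.Normal.map inferInstance ψ hsurj
    have hle : relSubgroup s ≤ (relSubgroup r).map ψ := by
      refine relSubgroup_le ?_ fun k => ⟨_, mem_relSubgroup r (e.symm k), rfl⟩
      rw [Subgroup.coe_map]
      exact ((isClosed_relSubgroup r).isCompact.image hψ).isClosed
    obtain ⟨b, hb, hba⟩ := hle ha'
    have hba' : b⁻¹ * a ∈ ψ.ker := by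
      rw [MonoidHom.mem_ker, map_mul, map_inv, hba, inv_mul_cancel]
    have hkerle : ψ.ker ≤ relSubgroup r := by
      rw [hker]
      refine Subgroup.topologicalClosure_minimal _ (Subgroup.normalClosure_le_normal ?_)
        (isClosed_relSubgroup r)
      rintro _ ⟨j, rfl⟩
      exact mem_relSubgroup r j
    have := mul_mem hb (hkerle hba')
    rwa [mul_inv_cancel_left] at this

theorem measurable_Theta (p n : ℕ) [Fact p.Prime] : Measurable (Theta p n) :=
  (continuous_Theta p n).measurable

theorem schMeasure_apply {A : Set (Sch p)} (hA : MeasurableSet A) :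
    schMeasure p n A = Measure.pi (fun _ : Fin n => oddHaar p n) (Theta p n ⁻¹' A) :=
  Measure.map_apply (measurable_Theta p n) hA

/-- A maximal linearly independent subfamily of a family of `n` vectors in `𝔽_p^n`, and vectors
that complete it to a generating system. -/
theorem exists_basis_rows {m : ℕ} {M : Fin n → Fin n → ZMod p}
    (hM : Module.finrank (ZMod p) (Submodule.span (ZMod p) (Set.range M)) + m = n) :
    ∃ (P : Fin n → Prop) (_ : {i // ¬ P i} ≃ Fin m) (v : Fin n → Fin n → ZMod p),
      Submodule.span (ZMod p) (Set.range fun j : {j // P j} => M j) =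
        Submodule.span (ZMod p) (Set.range M) ∧
      Nat.card {j // P j} + m = n ∧
      (∀ j, P j → v j = M j) ∧ Submodule.span (ZMod p) (Set.range v) = ⊤ := by
  classical
  obtain ⟨κ, a, hinj, hspan, hli⟩ := exists_linearIndependent' (ZMod p) M
  have hκ : Finite κ := Finite.of_injective a hinj
  have hfκ : Fintype κ := Fintype.ofFinite κ
  let P : Fin n → Prop := fun i => i ∈ Set.range a
  have hrange : (Set.range fun j : {j // P j} => M j) = Set.range (M ∘ a) := by
    ext x
    constructor
    · rintro ⟨⟨_, k, rfl⟩, rfl⟩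
      exact ⟨k, rfl⟩
    · rintro ⟨k, rfl⟩
      exact ⟨⟨a k, k, rfl⟩, rfl⟩
  have hcard : Nat.card {j // P j} + m = n := by
    have h1 : Nat.card {j // P j} = Fintype.card κ := by
      rw [← Nat.card_eq_fintype_card]
      exact (Nat.card_congr (Equiv.ofInjective a hinj)).symm
    rw [h1, ← finrank_span_eq_card hli, hspan, hM]
  have hcard' : Fintype.card {i // ¬ P i} = m := by
    rw [Fintype.card_subtype_compl, Fintype.card_fin, ← Nat.card_eq_fintype_card]
    omega
  let e : {i // ¬ P i} ≃ Fin m := Fintype.equivFinOfCardEq hcard'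
  obtain ⟨W', hW'⟩ := Submodule.exists_isCompl (Submodule.span (ZMod p) (Set.range M))
  have hdim : Module.finrank (ZMod p) W' = m := by
    have := Submodule.finrank_add_eq_of_isCompl hW'
    rw [Module.finrank_fin_fun] at this
    omega
  let b := Module.finBasisOfFinrankEq (ZMod p) W' hdim
  refine ⟨P, e, fun i => if h : P i then M i else b (e ⟨i, h⟩), by rw [hrange, hspan], hcard,
    fun j hj => by simp [hj], ?_⟩
  rw [eq_top_iff, ← hW'.sup_eq_top]
  refine sup_le ?_ ?_
  · rw [← hspan, ← hrange]
    refine Submodule.span_mono ?_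
    rintro _ ⟨j, rfl⟩
    exact ⟨j, by simp [j.2]⟩
  · have : Submodule.map W'.subtype (Submodule.span (ZMod p) (Set.range b)) = W' := by
      rw [b.span_eq, Submodule.map_top, Submodule.range_subtype]
    refine this.ge.trans ?_
    rw [Submodule.map_span]
    refine Submodule.span_mono ?_
    rintro _ ⟨_, ⟨k, rfl⟩, rfl⟩
    exact ⟨e.symm k, by simp [(e.symm k).2]⟩

/-- The part of `μ_n` on `Sch_m` coming from tuples with a given matrix of exponents of corank
`m` does not depend on that matrix, and is a multiple of `μ_m`. -/
theorem measure_expVec_inter_Theta (hp2 : 2 < p) {m : ℕ} {M : Fin n → Fin n → ZMod p}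
    (hM : Module.finrank (ZMod p) (Submodule.span (ZMod p) (Set.range M)) + m = n)
    {A : Set (Sch p)} (hA : MeasurableSet A) (hAm : A ⊆ SchEq p m) :
    (p : ℝ≥0∞) ^ (n ^ 2) * Measure.pi (fun _ : Fin n => oddHaar p n)
        {r | (∀ i, FreeProP.expVec (r i : FreeProP p n) = M i) ∧ Theta p n r ∈ A} =
      (p : ℝ≥0∞) ^ (m ^ 2) * schMeasure p m A := by
  classical
  have hprob := (isOddHaar_oddHaar p n hp2).1
  have hprob' := (isOddHaar_oddHaar p m hp2).1
  obtain ⟨P, e, v, hspan, hcard, hvP, hvtop⟩ := exists_basis_rows hM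
  set W := Submodule.span (ZMod p) (Set.range M) with hW
  choose z hz using FreeProP.exists_oddPart_expVec_eq (p := p) (n := n) hp2
  set d := Nat.card {j // P j} with hd
  have hWcard : (Nat.card W : ℝ≥0∞) = (p : ℝ≥0∞) ^ d := by
    rw [Module.natCard_eq_pow_finrank (K := ZMod p), Nat.card_zmod, Nat.cast_pow]
    congr 1
    omega
  have hp0 : (p : ℝ≥0∞) ≠ 0 := by exact_mod_cast hp.out.ne_zero
  have hpt : (p : ℝ≥0∞) ≠ ∞ := ENNReal.natCast_ne_top p
  let B : Set ({i // ¬ P i} → oddPart (FreeProP p m)) :=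
    (MeasurableEquiv.piCongrLeft (fun _ => oddPart (FreeProP p m)) e) ⁻¹' (Theta p m ⁻¹' A)
  have hBpre : MeasurePreserving
      (MeasurableEquiv.piCongrLeft (fun _ : Fin m => oddPart (FreeProP p m)) e)
      (Measure.pi fun _ : {i // ¬ P i} => oddHaar p m)
      (Measure.pi fun _ : Fin m => oddHaar p m) :=
    measurePreserving_piCongrLeft (fun _ => oddHaar p m) e
  have hΘA : MeasurableSet (Theta p m ⁻¹' A) := measurable_Theta p m hA
  have hB : MeasurableSet B := hBpre.measurable hΘA
  have hBmeas : Measure.pi (fun _ : {i // ¬ P i} => oddHaar p m) B = schMeasure p m A := by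
    rw [schMeasure_apply hA, ← hBpre.measure_preimage hΘA.nullMeasurableSet]
  have hBmem : ∀ t : {i // ¬ P i} → oddPart (FreeProP p m),
      t ∈ B ↔ Theta p m (fun k => t (e.symm k)) ∈ A := by
    intro t
    have : MeasurableEquiv.piCongrLeft (fun _ => oddPart (FreeProP p m)) e t =
        fun k => t (e.symm k) := by
      funext k
      obtain ⟨i, rfl⟩ := e.surjective k
      rw [e.symm_apply_apply]
      exact Equiv.piCongrLeft_apply_apply (fun _ => oddPart (FreeProP p m)) e t i
    rw [← this]
    exact Iff.rfl
  let S : Set (Fin n → oddPart (FreeProP p n)) :=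
    {r | (∀ i, FreeProP.expVec (r i : FreeProP p n) = M i) ∧ Theta p n r ∈ A}
  have hS : MeasurableSet S := (FreeProP.measurableSet_expVec_eq M).inter (measurable_Theta p n hA)
  let Φ := MeasurableEquiv.piEquivPiSubtypeProd (fun _ : Fin n => oddPart (FreeProP p n)) P
  have hΦ : MeasurePreserving Φ.symm ((Measure.pi fun _ : {i // P i} => oddHaar p n).prod
      (Measure.pi fun _ : {i // ¬ P i} => oddHaar p n))
      (Measure.pi fun _ : Fin n => oddHaar p n) :=
    (measurePreserving_piEquivPiSubtypeProd (fun _ : Fin n => oddHaar p n) P).symm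
  have hΦP : ∀ (x : {i // P i} → oddPart (FreeProP p n)) (y : {i // ¬ P i} → _) (i : Fin n)
      (h : P i), Φ.symm (x, y) i = x ⟨i, h⟩ := fun x y i h => by
    simp [Φ, MeasurableEquiv.piEquivPiSubtypeProd, Equiv.piEquivPiSubtypeProd, h]
  have hΦN : ∀ (x : {i // P i} → oddPart (FreeProP p n)) (y : {i // ¬ P i} → _) (i : Fin n)
      (h : ¬ P i), Φ.symm (x, y) i = y ⟨i, h⟩ := fun x y i h => by
    simp [Φ, MeasurableEquiv.piEquivPiSubtypeProd, Equiv.piEquivPiSubtypeProd, h]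
  let E : Set ({i // P i} → oddPart (FreeProP p n)) :=
    {x | ∀ i, FreeProP.expVec (x i : FreeProP p n) = M i}
  have hE : MeasurableSet E := FreeProP.measurableSet_expVec_eq _
  let c₀ : ℝ≥0∞ := ((p : ℝ≥0∞) ^ (d * m))⁻¹ * schMeasure p m A
  -- The measure of the fibre of `S` over the chosen independent relations `x`.
  have hfibre : ∀ x, Measure.pi (fun _ : {i // ¬ P i} => oddHaar p n)
      (Prod.mk x ⁻¹' (Φ.symm ⁻¹' S)) = E.indicator (fun _ => c₀) x := by
    intro x
    by_cases hx : x ∈ E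
    · rw [Set.indicator_of_mem hx]
      let y : Fin n → oddPart (FreeProP p n) := fun i => if h : P i then x ⟨i, h⟩ else z (v i)
      have hyP : ∀ j : {j // P j}, y j = x j := fun j => by simp [y, j.2]
      have hyv : ∀ i, FreeProP.expVec (y i : FreeProP p n) = v i := by
        intro i
        by_cases h : P i
        · rw [hyP ⟨i, h⟩, hvP i h]
          exact hx ⟨i, h⟩
        · simp [y, h, hz]
      obtain ⟨ψ, hψ, hsurj, hσ, hker⟩ := FreeProP.exists_quotient_hom P e
        (y := fun i => (y i : FreeProP p n)) (fun i => (y i).2) (by simp only [hyv]; exact hvtop)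
      simp only [hyP] at hker
      have hψx : ∀ j, ψ (x j) = 1 := by
        intro j
        have : (x j : FreeProP p n) ∈ ψ.ker := by
          rw [hker]
          exact Subgroup.le_topologicalClosure _ (Subgroup.subset_normalClosure ⟨j, rfl⟩)
        exact this
      have hWψ : ∀ c ∈ W, ∃ t, ψ t = 1 ∧ FreeProP.expVec t = c := by
        intro c hc
        have hc' : c ∈ Submodule.span (ZMod p)
            (FreeProP.expVec '' Set.range fun j => (x j : FreeProP p n)) := by
          rw [← Set.range_comp]
          have : (FreeProP.expVec ∘ fun j => (x j : FreeProP p n)) =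
              fun j : {j // P j} => M j := funext hx
          rw [this, hspan]
          exact hc
        obtain ⟨t, ht, htc⟩ := FreeProP.exists_mem_closure_expVec_eq hc'
        refine ⟨t, ?_, htc⟩
        have hle : Subgroup.closure (Set.range fun j => (x j : FreeProP p n)) ≤ ψ.ker := by
          rw [Subgroup.closure_le]
          rintro _ ⟨j, rfl⟩
          exact hψx j
        exact hle ht
      have hBW : ∀ r : {i // ¬ P i} → oddPart (FreeProP p n),
          (fun i => FreeProP.oddMap ψ hσ (r i)) ∈ B →
          ∀ i, FreeProP.expVec (r i : FreeProP p n) ∈ W := by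
        intro r hr i
        refine FreeProP.mem_of_expVec_map_eq_zero hψ hsurj hWψ hM ?_
        have h1 := (Theta_mem_SchEq _).1 (hAm ((hBmem _).1 hr))
        have h2 := generatorRank_schurGroup
          fun k => FreeProP.oddMap ψ hσ (r (e.symm k))
        rw [h1] at h2
        have h3 : expMatrix (fun k => FreeProP.oddMap ψ hσ (r (e.symm k))) = 0 := by
          have h0 : (expMatrix fun k => FreeProP.oddMap ψ hσ (r (e.symm k))).rank = 0 := by omega
          rw [Matrix.rank, Submodule.finrank_eq_zero, LinearMap.range_eq_bot] at h0
          exact Matrix.toLin'.injective (h0.trans (map_zero _).symm)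
        have h4 := congrFun h3 (e i)
        change FreeProP.expVec (ψ (r (e.symm (e i)))) = 0 at h4
        rwa [e.symm_apply_apply] at h4
      have hset : Prod.mk x ⁻¹' (Φ.symm ⁻¹' S) =
          {r | (∀ i : {i // ¬ P i}, FreeProP.expVec (r i : FreeProP p n) = M i) ∧
            (fun i => FreeProP.oddMap ψ hσ (r i)) ∈ B} := by
        ext r
        have hΘ : Theta p n (Φ.symm (x, r)) =
            Theta p m fun k => FreeProP.oddMap ψ hσ (r (e.symm k)) := by
          refine (Theta_eq_iff (a := ⟨n, _⟩) (b := ⟨m, _⟩)).2 ?_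
          have hx' : (fun j : {j // P j} => (Φ.symm (x, r) j : FreeProP p n)) =
              fun j => (x j : FreeProP p n) := funext fun j => by rw [hΦP x r j j.2]
          have hr' : (fun k => FreeProP.oddMap ψ hσ (Φ.symm (x, r) (e.symm k))) =
              fun k => FreeProP.oddMap ψ hσ (r (e.symm k)) :=
            funext fun k => by rw [hΦN x r _ (e.symm k).2]
          have := sigmaIso_schurGroup_of_quotient_hom e (Φ.symm (x, r)) hψ hsurj hσ
            (hx' ▸ hker)
          rwa [hr'] at this
        have hexp' : (∀ i, FreeProP.expVec (Φ.symm (x, r) i : FreeProP p n) = M i) ↔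
            ∀ i : {i // ¬ P i}, FreeProP.expVec (r i : FreeProP p n) = M i := by
          refine ⟨fun h i => by rw [← hΦN x r i i.2]; exact h i, fun h i => ?_⟩
          by_cases hi : P i
          · rw [hΦP x r i hi]
            exact hx ⟨i, hi⟩
          · rw [hΦN x r i hi]
            exact h ⟨i, hi⟩
        change (∀ i, FreeProP.expVec (Φ.symm (x, r) i : FreeProP p n) = M i) ∧
          Theta p n (Φ.symm (x, r)) ∈ A ↔ _
        rw [hΘ, hexp', Set.mem_ofPred_eq, hBmem]
      have hmain := FreeProP.measure_expVec_inter_preimage hp2 hψ hsurj hσ hWψ hB hBW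
        (fun i => M i) (fun i => Submodule.subset_span ⟨i, rfl⟩)
      rw [hset]
      rw [hBmeas, hWcard, Fintype.card_congr e, Fintype.card_fin, ← pow_mul] at hmain
      change _ = ((p : ℝ≥0∞) ^ (d * m))⁻¹ * schMeasure p m A
      rw [← hmain, ← mul_assoc, ENNReal.inv_mul_cancel (pow_ne_zero _ hp0)
        (ENNReal.pow_ne_top hpt), one_mul]
    · rw [Set.indicator_of_notMem hx]
      have : Prod.mk x ⁻¹' (Φ.symm ⁻¹' S) = ∅ := by
        refine Set.eq_empty_of_forall_notMem fun r hr => hx fun i => ?_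
        rw [← hΦP x r i i.2]
        exact hr.1 i
      rw [this, measure_empty]
  have hmeasE := FreeProP.measure_expVec_eq (n := n) hp2 fun i : {i // P i} => M i
  rw [← Nat.card_eq_fintype_card, ← hd, ← pow_mul] at hmeasE
  change _ * Measure.pi (fun _ : Fin n => oddHaar p n) S = _
  rw [← hΦ.measure_preimage hS.nullMeasurableSet,
    Measure.prod_apply (Φ.symm.measurable hS), lintegral_congr hfibre,
    lintegral_indicator_const hE]
  have hpow : n ^ 2 = m ^ 2 + d * m + n * d := by
    rw [← hcard]
    ring
  rw [hpow, pow_add, pow_add]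
  calc _ = (p : ℝ≥0∞) ^ (m ^ 2) * ((p : ℝ≥0∞) ^ (d * m) * c₀) *
        ((p : ℝ≥0∞) ^ (n * d) * Measure.pi (fun _ : {i // P i} => oddHaar p n) E) := by ring
    _ = _ := by
      rw [hmeasE, mul_one, ← mul_assoc ((p : ℝ≥0∞) ^ (d * m)),
        ENNReal.mul_inv_cancel (pow_ne_zero _ hp0) (ENNReal.pow_ne_top hpt), one_mul]

end Elimination

/-! ### The limit measure -/

section Limit

variable {p : ℕ} [hp : Fact p.Prime]

theorem isProbabilityMeasure_schMeasure (hp2 : 2 < p) (n : ℕ) :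
    IsProbabilityMeasure (schMeasure p n) := by
  have hprob := (isOddHaar_oddHaar p n hp2).1
  exact Measure.isProbabilityMeasure_map (measurable_Theta p n).aemeasurable

theorem schMeasure_eq_zero_of_lt {n m : ℕ} (hnm : n < m) {A : Set (Sch p)}
    (hA : MeasurableSet A) (hAm : A ⊆ SchEq p m) : schMeasure p n A = 0 := by
  have : Theta p n ⁻¹' A = ∅ := by
    refine Set.eq_empty_of_forall_notMem fun r hr => ?_
    have h1 := (Theta_mem_SchEq r).1 (hAm hr)
    have h2 := generatorRank_schurGroup r
    omega
  rw [schMeasure_apply hA, this, measure_empty]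

theorem schMeasure_eq_mul (hp2 : 2 < p) (m k : ℕ) {A : Set (Sch p)}
    (hA : MeasurableSet A) (hAm : A ⊆ SchEq p m) :
    schMeasure p (m + k) A =
      ENNReal.ofReal (constC p (m + k) ^ 2 / (constC p m ^ 2 * constC p k)) *
        schMeasure p m A := by
  classical
  set n := m + k with hn
  let R := {M : Fin n → Fin n → ZMod p //
    Module.finrank (ZMod p) (Submodule.span (ZMod p) (Set.range M)) = k}
  have hR : Fintype R := Fintype.ofFinite R
  let S : R → Set (Fin n → oddPart (FreeProP p n)) := fun M =>
    {r | (∀ i, FreeProP.expVec (r i : FreeProP p n) = M.1 i) ∧ Theta p n r ∈ A}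
  have hS : ∀ M, MeasurableSet (S M) := fun M =>
    (FreeProP.measurableSet_expVec_eq M.1).inter (measurable_Theta p n hA)
  have hunion : Theta p n ⁻¹' A = ⋃ M, S M := by
    ext r
    rw [Set.mem_iUnion]
    refine ⟨fun hr => ?_, fun ⟨M, hM⟩ => hM.2⟩
    have h1 := (Theta_mem_SchEq r).1 (hAm hr)
    have h2 := generatorRank_schurGroup r
    rw [h1, Matrix.rank_eq_finrank_span_row] at h2
    exact ⟨⟨fun i => FreeProP.expVec (r i : FreeProP p n), Nat.add_left_cancel h2⟩,
      fun _ => rfl, hr⟩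
  have hdisj : Pairwise (Function.onFun Disjoint S) := by
    intro M M' hMM
    refine Set.disjoint_left.2 fun r hr hr' => hMM (Subtype.ext (funext fun i => ?_))
    exact (hr.1 i).symm.trans (hr'.1 i)
  have hp0 : (p : ℝ≥0∞) ≠ 0 := by exact_mod_cast hp.out.ne_zero
  have hpt : (p : ℝ≥0∞) ≠ ∞ := ENNReal.natCast_ne_top p
  have hcount : (rankCount (ZMod p) (Fin n → ZMod p) n k : ℝ≥0∞) * (p : ℝ≥0∞) ^ (m ^ 2) =
      (p : ℝ≥0∞) ^ (n ^ 2) *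
        ENNReal.ofReal (constC p n ^ 2 / (constC p m ^ 2 * constC p k)) := by
    have h := congrArg ENNReal.ofReal (rankCount_corank hp2 m k)
    rw [ENNReal.ofReal_mul (Nat.cast_nonneg _), ENNReal.ofReal_mul (by positivity),
      ENNReal.ofReal_pow (Nat.cast_nonneg _), ENNReal.ofReal_pow (Nat.cast_nonneg _),
      ENNReal.ofReal_natCast, ENNReal.ofReal_natCast] at h
    exact h
  have hmain : (p : ℝ≥0∞) ^ (n ^ 2) * schMeasure p n A =
      (p : ℝ≥0∞) ^ (n ^ 2) * (ENNReal.ofReal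
        (constC p n ^ 2 / (constC p m ^ 2 * constC p k)) * schMeasure p m A) := by
    rw [schMeasure_apply hA, hunion, measure_iUnion hdisj hS, tsum_fintype, Finset.mul_sum,
      Finset.sum_congr rfl fun M _ => measure_expVec_inter_Theta hp2 (m := m)
        (by rw [M.2, hn, add_comm]) hA hAm,
      Finset.sum_const, nsmul_eq_mul, Finset.card_univ, ← Nat.card_eq_fintype_card, ← mul_assoc,
      ← mul_assoc, ← hcount]
    rfl
  exact (ENNReal.mul_right_inj (pow_ne_zero _ hp0) (ENNReal.pow_ne_top hpt)).1 hmain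

theorem schMeasure_eq_corankCoeff_mul (hp2 : 2 < p) (n m : ℕ) {A : Set (Sch p)}
    (hA : MeasurableSet A) (hAm : A ⊆ SchEq p m) :
    schMeasure p n A = ENNReal.ofReal (corankCoeff p n m) * schMeasure p m A := by
  rw [corankCoeff]
  split_ifs with h
  · obtain ⟨k, rfl⟩ := Nat.exists_eq_add_of_le h
    rw [Nat.add_sub_cancel_left]
    exact schMeasure_eq_mul hp2 m k hA hAm
  · rw [schMeasure_eq_zero_of_lt (not_le.1 h) hA hAm, ENNReal.ofReal_zero, zero_mul]

theorem measurableSet_SchEq (m : ℕ) : MeasurableSet (SchEq p m) := (isOpen_SchEq m).measurableSet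

theorem schMeasure_eq_tsum (hp2 : 2 < p) (n : ℕ) {A : Set (Sch p)} (hA : MeasurableSet A) :
    schMeasure p n A = ∑' m, ENNReal.ofReal (corankCoeff p n m) *
      schMeasure p m (A ∩ SchEq p m) := by
  have h : A = ⋃ m, A ∩ SchEq p m := by rw [← Set.inter_iUnion, iUnion_SchEq, Set.inter_univ]
  conv_lhs => rw [h]
  rw [measure_iUnion (fun i j hij => ((pairwise_disjoint_SchEq p hij).mono
    Set.inter_subset_right Set.inter_subset_right)) fun m => hA.inter (measurableSet_SchEq m)]
  exact tsum_congr fun m => schMeasure_eq_corankCoeff_mul hp2 n m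
    (hA.inter (measurableSet_SchEq m)) Set.inter_subset_right

/-- The masses `μ_m(Sch_m)` are summable: the measure `μ_n` of total mass one is at least
`C_∞²` times `μ_m` on `Sch_m` for every `m ≤ n`. -/
theorem summable_schMeasure_SchEq (hp2 : 2 < p) :
    Summable fun m => (schMeasure p m (SchEq p m)).toReal := by
  have h0 := constCInf_pos hp2
  refine summable_of_sum_range_le (c := 1 / constCInf p ^ 2)
    (fun _ => ENNReal.toReal_nonneg) fun n => ?_
  have hprob := isProbabilityMeasure_schMeasure hp2 (p := p)
  rw [le_div_iff₀ (by positivity), Finset.sum_mul]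
  have h1 : ∑ m ∈ Finset.range n, ENNReal.ofReal (corankCoeff p n m) *
      schMeasure p m (SchEq p m) ≤ 1 := by
    have := schMeasure_eq_tsum hp2 n MeasurableSet.univ
    rw [measure_univ] at this
    rw [this]
    simp only [Set.univ_inter]
    exact ENNReal.sum_le_tsum _
  have h2 := ENNReal.toReal_mono ENNReal.one_ne_top h1
  rw [ENNReal.toReal_sum fun m _ => ENNReal.mul_ne_top ENNReal.ofReal_ne_top
    (measure_ne_top _ _), ENNReal.toReal_one] at h2
  refine le_trans (Finset.sum_le_sum fun m hm => ?_) h2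
  rw [ENNReal.toReal_mul, ENNReal.toReal_ofReal (corankCoeff_nonneg hp2 n m), mul_comm]
  exact mul_le_mul_of_nonneg_right (le_corankCoeff hp2 (Finset.mem_range.1 hm).le)
    ENNReal.toReal_nonneg

/-- The limit measure `μ_∞`, given on each `Sch_m` as a multiple of `μ_m`. -/
def limitMeasure (p : ℕ) [Fact p.Prime] : Measure (Sch p) :=
  Measure.sum fun m => ENNReal.ofReal (constCInf p / constC p m ^ 2) •
    (schMeasure p m).restrict (SchEq p m)

theorem limitMeasure_apply {A : Set (Sch p)} (hA : MeasurableSet A) :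
    limitMeasure p A = ∑' m, ENNReal.ofReal (constCInf p / constC p m ^ 2) *
      schMeasure p m (A ∩ SchEq p m) := by
  rw [limitMeasure, Measure.sum_apply _ hA]
  refine tsum_congr fun m => ?_
  rw [Measure.smul_apply, Measure.restrict_apply hA, smul_eq_mul]

theorem tendsto_schMeasure (hp2 : 2 < p) {A : Set (Sch p)} (hA : MeasurableSet A) :
    Tendsto (fun n => schMeasure p n A) atTop (𝓝 (limitMeasure p A)) := by
  have hprob := isProbabilityMeasure_schMeasure hp2 (p := p)
  have h0 := constCInf_pos hp2
  let b : ℕ → ℝ := fun m => (schMeasure p m (A ∩ SchEq p m)).toReal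
  have hb0 : ∀ m, 0 ≤ b m := fun _ => ENNReal.toReal_nonneg
  have hb : ∀ m, b m ≤ (schMeasure p m (SchEq p m)).toReal := fun m =>
    ENNReal.toReal_mono (measure_ne_top _ _) (measure_mono Set.inter_subset_right)
  have hbound : Summable fun m =>
      1 / constCInf p ^ 3 * (schMeasure p m (SchEq p m)).toReal :=
    (summable_schMeasure_SchEq hp2).mul_left _
  have hle : ∀ n m, corankCoeff p n m * b m ≤
      1 / constCInf p ^ 3 * (schMeasure p m (SchEq p m)).toReal := fun n m =>
    mul_le_mul (corankCoeff_le hp2 n m) (hb m) (hb0 m) (by positivity)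
  have hlim : ∀ m, Tendsto (fun n => corankCoeff p n m * b m) atTop
      (𝓝 (constCInf p / constC p m ^ 2 * b m)) := fun m =>
    (tendsto_corankCoeff hp2 m).mul_const _
  have hnn : ∀ n m, 0 ≤ corankCoeff p n m * b m := fun n m =>
    mul_nonneg (corankCoeff_nonneg hp2 n m) (hb0 m)
  have hnn' : ∀ m, 0 ≤ constCInf p / constC p m ^ 2 * b m := fun m =>
    ge_of_tendsto' (hlim m) fun n => hnn n m
  have hsum : ∀ n, Summable fun m => corankCoeff p n m * b m := fun n =>
    hbound.of_nonneg_of_le (hnn n) (hle n)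
  have hsum' : Summable fun m => constCInf p / constC p m ^ 2 * b m :=
    hbound.of_nonneg_of_le hnn' fun m => le_of_tendsto' (hlim m) fun n => hle n m
  have hdom := tendsto_tsum_of_dominated_convergence hbound hlim
    (Eventually.of_forall fun n m => by
      rw [Real.norm_of_nonneg (hnn n m)]
      exact hle n m)
  have hbr : ∀ (c : ℝ) (m : ℕ), 0 ≤ c → ENNReal.ofReal (c * b m) =
      ENNReal.ofReal c * schMeasure p m (A ∩ SchEq p m) := fun c m hc => by
    rw [ENNReal.ofReal_mul hc, ENNReal.ofReal_toReal (measure_ne_top _ _)]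
  have hn : ∀ n, schMeasure p n A = ENNReal.ofReal (∑' m, corankCoeff p n m * b m) := by
    intro n
    rw [schMeasure_eq_tsum hp2 n hA, ENNReal.ofReal_tsum_of_nonneg (hnn n) (hsum n)]
    exact tsum_congr fun m => (hbr _ m (corankCoeff_nonneg hp2 n m)).symm
  have hinf : limitMeasure p A =
      ENNReal.ofReal (∑' m, constCInf p / constC p m ^ 2 * b m) := by
    rw [limitMeasure_apply hA, ENNReal.ofReal_tsum_of_nonneg hnn' hsum']
    exact tsum_congr fun m => (hbr _ m (by positivity)).symm
  simp only [hn, hinf]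
  exact ENNReal.tendsto_ofReal hdom

theorem isProbabilityMeasure_limitMeasure (hp2 : 2 < p) :
    IsProbabilityMeasure (limitMeasure p) := by
  have hprob := isProbabilityMeasure_schMeasure hp2 (p := p)
  have h := tendsto_schMeasure hp2 MeasurableSet.univ
  simp only [measure_univ] at h
  exact ⟨tendsto_nhds_unique h tendsto_const_nhds⟩

theorem limitMeasure_restrict (m : ℕ) : (limitMeasure p).restrict (SchEq p m) =
    ENNReal.ofReal (constCInf p / constC p m ^ 2) • (schMeasure p m).restrict (SchEq p m) := by
  refine Measure.ext fun A hA => ?_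
  rw [Measure.restrict_apply hA, limitMeasure_apply (hA.inter (measurableSet_SchEq m)),
    tsum_eq_single m, Measure.smul_apply, Measure.restrict_apply hA, smul_eq_mul,
    Set.inter_assoc, Set.inter_self]
  intro k hk
  have : A ∩ SchEq p m ∩ SchEq p k = ∅ := by
    rw [Set.inter_assoc, (pairwise_disjoint_SchEq p hk.symm).inter_eq, Set.inter_empty]
  rw [this, measure_empty, mul_zero]

end Limit

end

theorem mainTheorem1 (p : ℕ) [Fact p.Prime] (hp : 2 < p) :
    ∃ μ : Measure (Sch p),
      (IsProbabilityMeasure μ ∧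
        ∀ A : Set (Sch p), MeasurableSet A →
          Tendsto (fun n => schMeasure p n A) atTop (𝓝 (μ A))) ∧
      (∀ ν : Measure (Sch p),
        (IsProbabilityMeasure ν ∧
          ∀ A : Set (Sch p), MeasurableSet A →
            Tendsto (fun n => schMeasure p n A) atTop (𝓝 (ν A))) → ν = μ) ∧
      ∀ m : ℕ, μ.restrict (SchEq p m) =
        ENNReal.ofReal (constCInf p / constC p m ^ 2) •
          (schMeasure p m).restrict (SchEq p m) := by
  refine ⟨limitMeasure p, ⟨isProbabilityMeasure_limitMeasure hp,
    fun A hA => tendsto_schMeasure hp hA⟩, fun ν hν => ?_, limitMeasure_restrict⟩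
  exact Measure.ext fun A hA => tendsto_nhds_unique (hν.2 A hA) (tendsto_schMeasure hp hA)
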